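/- **Setting.** Let $T\ge 0$, let $\Omega=\{\omega\in C([0,T],\mathbb R):\omega_0=0\}$ with the uniform norm and its Borel $\sigma$-field, let $B$ be the coordinate process and $\mathcal F_t=\sigma(B_s:s\le t)$. Let $\bar\mu$ be a nonzero finite measure on $[0,T]$ whose distribution function $\bar\mu_t=\bar\mu([0,t])$ is continuous. Let $\mathbf P$ be a set of probability measures on $\Omega$ such that, for every $P\in\mathbf P$, $B$ is a $P$-martingale with respect to $(\mathcal F_t)$ and, $\langle B\rangle^P$ denoting its quadratic variation under $P$, the process $\bar\mu_t-\langle B\rangle^P_t$ is nondecreasing $P$-a.s. For bounded continuous $f$ put $c(f)=\sup_{P\in\mathbf P}\|f\|_{L^2(P)}$; for lower semicontinuous $f\ge 0$ put $c(f)=\sup\{c(\varphi):\varphi\in C_b(\Omega),\ 0\le\varphi\le f\}$; for arbitrary $g$ put $c(g)=\inf\{c(f): f \text{ lower semicontinuous},\ f\ge |g|\}$. A property holds quasi-surely if the indicator function $\mathbb 1_A$ of the set $A$ where it fails satisfies $c(\mathbb 1_A)=0$. Let $\mathcal L$ be the completion of $C_b(\Omega)$ for the semi-norm $c$, realised as the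 space of all functions $f:\Omega\to\mathbb R$ for which there are $f_n\in C_b(\Omega)$ with $c(f-f_n)\to0$; functions in $\mathcal L$ which are quasi-surely equal are identified when $\mathcal L$ is regarded as a normed space. Let $\mathcal H_e$ be the vector space of elementary processes $h_s=\sum_{i=0}^{N}k_{t_i}\mathbb 1_{]t_i,t_{i+1}]}(s)$, where $0\le t_0\le t_1\le\dots\le t_{N+1}\le T$ are deterministic and each $k_{t_i}:\Omega\to\mathbb R$ is bounded, continuous and $\mathcal F_{t_i}$-measurable. Let $\mathcal H$ be the completion of $\mathcal H_e$ (elements at distance $0$ being identified) for the semi-norm $$\|h\|_{\mathcal H}=\sup_{P\in\mathbf P}\Big(E_P\int_0^T h_s^2\,d\bar\mu_s\Big)^{1/2}.$$ **Theorem 2.8.** The formula $$h=\sum_{i=0}^{N}k_{t_i}\mathbb 1_{]t_i,t_{i+1}]}\ \longmapsto\ I_T(h)=\sum_{i=0}^{N}k_{t_i}\,(B_{t_{i+1}}-B_{t_i})$$ gives a well-defined linear mapping from $\mathcal H_e$ to $\mathcal L$ and $$c(I_T(h))\le\|h\|_{\mathcal H}\qquad(h\in\mathcal H_e).$$ It extends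 uniquely to a continuous linear mapping $I_T:\mathcal H\to\mathcal L$ (uniqueness being up to quasi-sure equality), and the extension satisfies $c(I_T(h))\le\|h\|_{\mathcal H}$ for all $h\in\mathcal H$. -/

import Mathlib

open MeasureTheory ProbabilityTheory Filter Topology
open scoped ENNReal NNReal BoundedContinuousFunction

namespace QSInt

noncomputable section

/-- The time interval `[0, T]`. -/
abbrev TimeInt (T : ℝ) : Type := Set.Icc (0 : ℝ) T

section PathSpace

/-- The path space `Ω`: real continuous functions on `[0, T]` vanishing at time `0`. -/
def PathSpace (T : ℝ) [Fact (0 ≤ T)] : Type := {ω : C(TimeInt T, ℝ) // ω ⊥ = 0}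

variable (T : ℝ) [Fact (0 ≤ T)]

/-- `Ω` carries the uniform distance. -/
instance : MetricSpace (PathSpace T) :=
  inferInstanceAs (MetricSpace {ω : C(TimeInt T, ℝ) // ω ⊥ = 0})

instance : SecondCountableTopology (PathSpace T) :=
  inferInstanceAs (SecondCountableTopology {ω : C(TimeInt T, ℝ) // ω ⊥ = 0})

/-- `Ω` carries its Borel `σ`-field. -/
instance : MeasurableSpace (PathSpace T) := borel (PathSpace T)

instance : BorelSpace (PathSpace T) := ⟨rfl⟩

variable {T}

/-- The coordinate process `B`. -/
def coord (t : TimeInt T) (ω : PathSpace T) : ℝ := ω.1 t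

theorem continuous_coord (t : TimeInt T) : Continuous (coord t) :=
  (ContinuousEvalConst.continuous_eval_const t).comp continuous_subtype_val

variable (T) in
/-- The canonical filtration, `𝓕 t = σ(B s : s ≤ t)`. -/
def canonicalFiltration : Filtration (TimeInt T) (inferInstance : MeasurableSpace (PathSpace T)) :=
  Filtration.natural coord fun t => (continuous_coord t).stronglyMeasurable

/-- `P` is a martingale measure: the coordinate process is a martingale under `P` for the
canonical filtration. -/
def IsMartingaleMeasure (P : ProbabilityMeasure (PathSpace T)) : Prop :=
  Martingale coord (canonicalFiltration T) (P : Measure (PathSpace T))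

/-- `A` is (a version of) the quadratic variation `⟨B⟩` of the coordinate process under `P`: an
adapted process which is almost surely null at `0`, continuous and nondecreasing, and for which
`B ^ 2 - A` is a local martingale. -/
structure IsQuadraticVariation (P : ProbabilityMeasure (PathSpace T)) (A : TimeInt T → PathSpace T → ℝ) :
    Prop where
  adapted : StronglyAdapted (canonicalFiltration T) A
  zero : ∀ᵐ ω ∂(P : Measure (PathSpace T)), A ⊥ ω = 0
  continuous : ∀ᵐ ω ∂(P : Measure (PathSpace T)), Continuous fun t => A t ω
  monotone : ∀ᵐ ω ∂(P : Measure (PathSpace T)), Monotone fun t => A t ω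
  localMartingale :
    Locally (fun X => Martingale X (canonicalFiltration T) (P : Measure (PathSpace T)))
      (canonicalFiltration T) (fun t ω => coord t ω ^ 2 - A t ω) (P : Measure (PathSpace T))

/-- The distribution function `t ↦ μ [0, t]` of a measure on `[0, T]`. -/
def distFun (μ : Measure (TimeInt T)) (t : TimeInt T) : ℝ := μ.real (Set.Iic t)

/-- `d⟨B⟩ ≤ dμ` under `P`: for the quadratic variation `⟨B⟩` of the coordinate process under `P`
(unique up to indistinguishability), the process `t ↦ μ [0, t] - ⟨B⟩ t` is almost surely
nondecreasing. -/
def BracketLE (μ : Measure (TimeInt T)) (P : ProbabilityMeasure (PathSpace T)) : Prop :=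
  ∃ A : TimeInt T → PathSpace T → ℝ, IsQuadraticVariation P A ∧
    ∀ᵐ ω ∂(P : Measure (PathSpace T)), Monotone fun t => distFun μ t - A t ω

end PathSpace

section Capacity

variable {T : ℝ} [Fact (0 ≤ T)] (𝔓 : Set (ProbabilityMeasure (PathSpace T)))

/-- The capacity of a bounded continuous function: `sup {‖φ‖_{L²(P)} : P ∈ 𝔓}`. -/
def capCb (φ : PathSpace T →ᵇ ℝ) : ℝ≥0∞ := ⨆ P : 𝔓, eLpNorm φ 2 (P.1 : Measure (PathSpace T))

/-- The capacity of a (lower semicontinuous) function `f ≥ 0`: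
`sup {c(φ) : φ ∈ C_b(Ω), 0 ≤ φ ≤ f}`. -/
def capLsc (f : PathSpace T → ℝ≥0∞) : ℝ≥0∞ :=
  ⨆ (φ : PathSpace T →ᵇ ℝ) (_ : 0 ≤ φ ∧ ∀ ω, ENNReal.ofReal (φ ω) ≤ f ω), capCb 𝔓 φ

/-- The capacity of an arbitrary function `g ≥ 0`:
`inf {c(f) : f lower semicontinuous, f ≥ g}`. -/
def cap (g : PathSpace T → ℝ≥0∞) : ℝ≥0∞ :=
  ⨅ (f : PathSpace T → ℝ≥0∞) (_ : LowerSemicontinuous f ∧ g ≤ f), capLsc 𝔓 f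

/-- The capacity `c(f) = c(|f|)` of an arbitrary real function. -/
def capFun (f : PathSpace T → ℝ) : ℝ≥0∞ := cap 𝔓 fun ω => ‖f ω‖ₑ

/-- The capacity of a set, `c(A) = c(1_A)`. -/
def capSet (A : Set (PathSpace T)) : ℝ≥0∞ := cap 𝔓 (A.indicator 1)

/-- A property holds quasi-surely if it holds outside a polar set, that is a set of zero
capacity. -/
def QuasiSurely (p : PathSpace T → Prop) : Prop := capSet 𝔓 {ω | ¬ p ω} = 0

theorem exists_bump {f : PathSpace T → ℝ≥0∞} (hf : LowerSemicontinuous f) (ω : PathSpace T) (r : ℝ≥0)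
    (hr : (r : ℝ≥0∞) < f ω) :
    ∃ φ : PathSpace T →ᵇ ℝ, 0 ≤ φ ∧ (∀ x, ENNReal.ofReal (φ x) ≤ f x) ∧ φ ω = r := by
  obtain ⟨δ, hδ, hball⟩ := Metric.isOpen_iff.1 (hf.isOpen_preimage r) ω hr
  have hc : Continuous fun x : PathSpace T => (r : ℝ) * max 0 (1 - dist x ω / δ) := by fun_prop
  have h0 : ∀ x, 0 ≤ (r : ℝ) * max 0 (1 - dist x ω / δ) := fun x => by positivity
  have h1 : ∀ x, (r : ℝ) * max 0 (1 - dist x ω / δ) ≤ r := fun x => by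
    have : max 0 (1 - dist x ω / δ) ≤ 1 := by
      have : 0 ≤ dist x ω / δ := by positivity
      exact max_le (by norm_num) (by linarith)
    nlinarith [r.2]
  refine ⟨BoundedContinuousFunction.ofNormedAddCommGroup _ hc r fun x => ?_, ?_, ?_, ?_⟩
  · rw [Real.norm_of_nonneg (h0 x)]; exact h1 x
  · exact fun x => h0 x
  · intro x
    change ENNReal.ofReal ((r : ℝ) * max 0 (1 - dist x ω / δ)) ≤ f x
    by_cases hx : dist x ω < δ
    · refine le_trans (ENNReal.ofReal_le_ofReal (h1 x)) ?_
      rw [ENNReal.ofReal_coe_nnreal]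
      exact (hball (Metric.mem_ball.2 hx)).le
    · have : 1 - dist x ω / δ ≤ 0 := by
        rw [sub_nonpos, le_div_iff₀ hδ]; linarith
      rw [max_eq_left this]; simp
  · change (r : ℝ) * max 0 (1 - dist ω ω / δ) = r
    simp

theorem exists_seq_approx {f : PathSpace T → ℝ≥0∞} (hf : LowerSemicontinuous f) :
    ∃ ψ : ℕ → PathSpace T →ᵇ ℝ, Monotone ψ ∧ (∀ n, 0 ≤ ψ n) ∧
      ∀ ω, ⨆ n, ENNReal.ofReal (ψ n ω) = f ω := by
  let S : Set (PathSpace T →ᵇ ℝ) := {φ | 0 ≤ φ ∧ ∀ ω, ENNReal.ofReal (φ ω) ≤ f ω}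
  let j : (PathSpace T →ᵇ ℝ) → PathSpace T → ℝ≥0∞ := fun φ ω => ENNReal.ofReal (φ ω)
  have hL : IsLUB (j '' S) f := by
    constructor
    · rintro _ ⟨φ, hφ, rfl⟩; exact hφ.2
    · intro g hg ω
      refine le_of_forall_lt fun c hc => ?_
      obtain ⟨r, hr1, hr2⟩ := ENNReal.lt_iff_exists_nnreal_btwn.1 hc
      obtain ⟨φ, h0, h1, h2⟩ := exists_bump hf ω r hr2
      have := hg ⟨φ, ⟨h0, h1⟩, rfl⟩ ω
      simp only [j, h2, ENNReal.ofReal_coe_nnreal] at this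
      exact hr1.trans_le this
  obtain ⟨F, hFs, hFc, hFl⟩ := exists_countable_lowerSemicontinuous_isLUB
    (𝓕 := j '' S) (s := f) (by
      rintro _ ⟨φ, -, rfl⟩
      exact (ENNReal.continuous_ofReal.comp φ.continuous).lowerSemicontinuous) hL
  have h0S : (0 : PathSpace T →ᵇ ℝ) ∈ S := ⟨le_rfl, fun ω => by simp⟩
  have hF' : (insert (j 0) F).Countable := hFc.insert _
  obtain ⟨u, hu⟩ := hF'.exists_eq_range ⟨_, Set.mem_insert _ _⟩
  have hmem : ∀ n, ∃ φ ∈ S, j φ = u n := fun n => by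
    have : u n ∈ insert (j 0) F := hu ▸ Set.mem_range_self n
    rcases this with h | h
    · exact ⟨0, h0S, h.symm⟩
    · exact hFs h
  choose φ hφS hφ using hmem
  have hsup : ∀ n ω, (partialSups φ n) ω ∈ Set.range fun m => φ m ω := by
    intro n ω
    induction n with
    | zero => exact ⟨0, by simp⟩
    | succ n ih =>
      rw [partialSups_add_one]
      change max ((partialSups φ n) ω) (φ (n + 1) ω) ∈ _
      rcases max_choice ((partialSups φ n) ω) (φ (n + 1) ω) with h | h <;> rw [h]
      · exact ih
      · exact ⟨n + 1, rfl⟩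
  refine ⟨partialSups φ, (partialSups φ).monotone,
    fun n => (hφS 0).1.trans ((le_partialSups φ 0).trans ((partialSups φ).monotone n.zero_le)),
    fun ω => le_antisymm (iSup_le fun n => ?_) ?_⟩
  · obtain ⟨m, hm⟩ := hsup n ω
    change φ m ω = _ at hm
    rw [← hm]; exact (hφS m).2 ω
  · have : f ≤ fun ω => ⨆ n, ENNReal.ofReal (partialSups φ n ω) := by
      refine hFl.2 fun g hg ω => ?_
      have : g ∈ Set.range u := hu ▸ Set.mem_insert_of_mem _ hg
      obtain ⟨n, rfl⟩ := this
      rw [← hφ n]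
      exact le_iSup_of_le n (ENNReal.ofReal_le_ofReal (le_partialSups φ n ω))
    exact this ω

theorem eLpNorm_two_enn (f : PathSpace T → ℝ≥0∞) (μ : Measure (PathSpace T)) :
    eLpNorm f 2 μ = (∫⁻ ω, f ω ^ (2 : ℝ) ∂μ) ^ (1 / 2 : ℝ) := by
  rw [eLpNorm_eq_lintegral_rpow_enorm_toReal (by norm_num) (by norm_num)]
  simp

theorem eLpNorm_bcf {φ : PathSpace T →ᵇ ℝ} (h : 0 ≤ φ) (μ : Measure (PathSpace T)) :
    eLpNorm φ 2 μ = eLpNorm (fun ω => ENNReal.ofReal (φ ω)) 2 μ := by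
  refine eLpNorm_congr_enorm_ae (Eventually.of_forall fun ω => ?_)
  have h' : 0 ≤ φ ω := h ω
  rw [Real.enorm_of_nonneg h', enorm_eq_self]

/-- On lower semicontinuous functions the capacity is the supremum of the `L²` norms. -/
theorem capLsc_eq {f : PathSpace T → ℝ≥0∞} (hf : LowerSemicontinuous f) :
    capLsc 𝔓 f = ⨆ P : 𝔓, eLpNorm f 2 (P.1 : Measure (PathSpace T)) := by
  apply le_antisymm
  · refine iSup₂_le fun φ hφ => iSup_mono fun P => ?_
    rw [eLpNorm_bcf hφ.1]
    exact eLpNorm_mono_enorm fun ω => hφ.2 ω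
  · refine iSup_le fun P => ?_
    obtain ⟨ψ, hm, h0, hs⟩ := exists_seq_approx hf
    have key : eLpNorm f 2 (P.1 : Measure (PathSpace T)) =
        ⨆ n, eLpNorm (ψ n) 2 (P.1 : Measure (PathSpace T)) := by
      simp_rw [eLpNorm_bcf (h0 _), eLpNorm_two_enn, ← hs]
      have e1 : ∀ ω, (⨆ n, ENNReal.ofReal (ψ n ω)) ^ (2 : ℝ) =
          ⨆ n, ENNReal.ofReal (ψ n ω) ^ (2 : ℝ) := fun ω =>
        (ENNReal.orderIsoRpow 2 (by norm_num)).map_iSup _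
      simp_rw [e1]
      rw [lintegral_iSup]
      · exact (ENNReal.orderIsoRpow (1 / 2) (by norm_num)).map_iSup _
      · intro n
        exact ((ψ n).continuous.measurable.ennreal_ofReal).pow_const _
      · intro a b hab ω
        exact ENNReal.rpow_le_rpow (ENNReal.ofReal_le_ofReal (hm hab ω)) (by norm_num)
    rw [key]
    refine iSup_le fun n => ?_
    refine le_trans ?_ (le_iSup₂_of_le (ψ n) ⟨h0 n, fun ω => ?_⟩ le_rfl)
    · exact le_iSup (fun P : 𝔓 => eLpNorm (ψ n) 2 (P.1 : Measure (PathSpace T))) P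
    · rw [← hs]; exact le_iSup (fun n => ENNReal.ofReal (ψ n ω)) n

theorem cap_mono {f g : PathSpace T → ℝ≥0∞} (h : f ≤ g) : cap 𝔓 f ≤ cap 𝔓 g :=
  le_iInf₂ fun u hu => iInf₂_le u ⟨hu.1, h.trans hu.2⟩

theorem cap_of_lsc {f : PathSpace T → ℝ≥0∞} (hf : LowerSemicontinuous f) :
    cap 𝔓 f = ⨆ P : 𝔓, eLpNorm f 2 (P.1 : Measure (PathSpace T)) := by
  refine le_antisymm ((iInf₂_le f ⟨hf, le_rfl⟩).trans (capLsc_eq 𝔓 hf).le) ?_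
  refine le_iInf₂ fun u hu => ?_
  rw [capLsc_eq 𝔓 hu.1]
  exact iSup_mono fun P => eLpNorm_mono_enorm fun ω => hu.2 ω

theorem exists_lsc_of_cap_lt {g : PathSpace T → ℝ≥0∞} {c : ℝ≥0∞} (h : cap 𝔓 g < c) :
    ∃ f, LowerSemicontinuous f ∧ g ≤ f ∧ cap 𝔓 f < c := by
  obtain ⟨f, hf⟩ := iInf_lt_iff.1 h
  obtain ⟨⟨h1, h2⟩, h3⟩ := iInf_lt_iff.1 hf
  exact ⟨f, h1, h2, by rwa [cap_of_lsc 𝔓 h1, ← capLsc_eq 𝔓 h1]⟩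

theorem cap_tsum_le_of_lsc {f : ℕ → PathSpace T → ℝ≥0∞} (hf : ∀ n, LowerSemicontinuous (f n)) :
    cap 𝔓 (fun ω => ∑' n, f n ω) ≤ ∑' n, cap 𝔓 (f n) := by
  have hs : LowerSemicontinuous fun ω => ∑' n, f n ω := lowerSemicontinuous_tsum hf
  rw [cap_of_lsc 𝔓 hs]
  refine iSup_le fun P => ?_
  have e : ∀ ω, ∑' n, f n ω = ⨆ N, ∑ n ∈ Finset.range N, f n ω := fun ω =>
    ENNReal.tsum_eq_iSup_nat
  have hmeas : ∀ n, Measurable (f n) := fun n => (hf n).measurable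
  simp_rw [e]
  rw [eLpNorm_two_enn]
  have e1 : ∀ ω, (⨆ N, ∑ n ∈ Finset.range N, f n ω) ^ (2 : ℝ) =
      ⨆ N, (∑ n ∈ Finset.range N, f n ω) ^ (2 : ℝ) := fun ω =>
    (ENNReal.orderIsoRpow 2 (by norm_num)).map_iSup _
  simp_rw [e1]
  rw [lintegral_iSup]
  · refine le_trans
      ((ENNReal.orderIsoRpow (1 / 2) (by norm_num)).map_iSup _).le (iSup_le fun N => ?_)
    change (∫⁻ ω, (∑ n ∈ Finset.range N, f n ω) ^ (2 : ℝ) ∂(P.1 : Measure (PathSpace T))) ^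
      (1 / 2 : ℝ) ≤ _
    rw [← eLpNorm_two_enn (fun ω => ∑ n ∈ Finset.range N, f n ω)]
    have e2 : (fun ω => ∑ n ∈ Finset.range N, f n ω) = ∑ n ∈ Finset.range N, f n := by
      ext ω; simp
    rw [e2]
    refine (eLpNorm_sum_le (fun n _ => (hmeas n).aestronglyMeasurable) (by norm_num)).trans ?_
    refine le_trans (Finset.sum_le_sum fun n _ => ?_) (ENNReal.sum_le_tsum (Finset.range N))
    rw [cap_of_lsc 𝔓 (hf n)]
    exact le_iSup (fun P : 𝔓 => eLpNorm (f n) 2 (P.1 : Measure (PathSpace T))) P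
  · intro N
    exact (Finset.measurable_fun_sum _ fun n _ => hmeas n).pow_const _
  · intro a b hab ω
    exact ENNReal.rpow_le_rpow
      (Finset.sum_le_sum_of_subset (Finset.range_mono hab)) (by norm_num)

theorem cap_add_le (f g : PathSpace T → ℝ≥0∞) : cap 𝔓 (f + g) ≤ cap 𝔓 f + cap 𝔓 g := by
  refine ENNReal.le_of_forall_pos_le_add fun ε hε hlt => ?_
  have hε' : ((ε / 2 : ℝ≥0) : ℝ≥0∞) ≠ 0 := by simpa using hε.ne'
  have hf : cap 𝔓 f ≠ ∞ := ((le_self_add).trans_lt hlt).ne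
  have hg : cap 𝔓 g ≠ ∞ := ((le_add_self).trans_lt hlt).ne
  obtain ⟨u, hu, hfu, hu'⟩ := exists_lsc_of_cap_lt 𝔓 (ENNReal.lt_add_right hf hε')
  obtain ⟨v, hv, hgv, hv'⟩ := exists_lsc_of_cap_lt 𝔓 (ENNReal.lt_add_right hg hε')
  calc cap 𝔓 (f + g) ≤ cap 𝔓 (u + v) := cap_mono 𝔓 (add_le_add hfu hgv)
    _ = ⨆ P : 𝔓, eLpNorm (u + v) 2 (P.1 : Measure (PathSpace T)) := cap_of_lsc 𝔓 (hu.add hv)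
    _ ≤ cap 𝔓 u + cap 𝔓 v := by
      refine iSup_le fun P => ?_
      refine (eLpNorm_add_le hu.measurable.aestronglyMeasurable
        hv.measurable.aestronglyMeasurable (by norm_num)).trans ?_
      rw [cap_of_lsc 𝔓 hu, cap_of_lsc 𝔓 hv]
      exact add_le_add (le_iSup (fun P : 𝔓 => eLpNorm u 2 (P.1 : Measure (PathSpace T))) P)
        (le_iSup (fun P : 𝔓 => eLpNorm v 2 (P.1 : Measure (PathSpace T))) P)
    _ ≤ _ := add_le_add hu'.le hv'.le
    _ = cap 𝔓 f + cap 𝔓 g + ε := by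
      rw [show (ε : ℝ≥0∞) = (ε / 2 : ℝ≥0) + (ε / 2 : ℝ≥0) by
        rw [← ENNReal.coe_add, add_halves]]
      ring

theorem capFun_zero : capFun 𝔓 0 = 0 := by
  have : (fun ω : PathSpace T => ‖(0 : PathSpace T → ℝ) ω‖ₑ) = fun _ => 0 := by ext; simp
  rw [capFun, this, cap_of_lsc 𝔓 lowerSemicontinuous_const]
  simp

theorem capFun_add_le (f g : PathSpace T → ℝ) : capFun 𝔓 (f + g) ≤ capFun 𝔓 f + capFun 𝔓 g :=
  (cap_mono 𝔓 fun ω => enorm_add_le (f ω) (g ω)).trans (cap_add_le 𝔓 _ _)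

theorem capFun_neg (f : PathSpace T → ℝ) : capFun 𝔓 (-f) = capFun 𝔓 f := by
  simp [capFun]

theorem capFun_smul_le (a : ℝ) (f : PathSpace T → ℝ) : capFun 𝔓 (a • f) ≤ ‖a‖ₑ * capFun 𝔓 f := by
  by_cases ha : a = 0
  · subst ha; simp [capFun_zero]
  have ha0 : ‖a‖ₑ ≠ 0 := by simpa using ha
  have hat : ‖a‖ₑ ≠ ∞ := enorm_ne_top
  rw [mul_comm, ← ENNReal.div_le_iff ha0 hat]
  refine le_iInf₂ fun u hu => ?_
  rw [ENNReal.div_le_iff ha0 hat, capLsc_eq 𝔓 hu.1, mul_comm]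
  have hlsc : LowerSemicontinuous fun ω => ‖a‖ₑ * u ω :=
    (ENNReal.continuous_const_mul hat).comp_lowerSemicontinuous hu.1
      fun x y h => mul_le_mul_right h _
  refine (cap_mono 𝔓 (g := fun ω => ‖a‖ₑ * u ω) fun ω => ?_).trans ?_
  · simp only [Pi.smul_apply, enorm_smul]
    exact mul_le_mul_right (hu.2 ω) _
  · rw [cap_of_lsc 𝔓 hlsc, ENNReal.mul_iSup]
    refine iSup_mono fun P => ?_
    simp_rw [eLpNorm_two_enn, ENNReal.mul_rpow_of_nonneg _ _ (show (0 : ℝ) ≤ 2 by norm_num)]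
    rw [lintegral_const_mul _ (hu.1.measurable.pow_const _),
      ENNReal.mul_rpow_of_nonneg _ _ (by norm_num), ← ENNReal.rpow_mul]
    norm_num

/-- On bounded continuous functions the extended capacity agrees with the original one. -/
theorem capFun_bcf (φ : PathSpace T →ᵇ ℝ) : capFun 𝔓 φ = capCb 𝔓 φ := by
  have : LowerSemicontinuous fun ω => ‖φ ω‖ₑ :=
    (continuous_enorm.comp φ.continuous).lowerSemicontinuous
  rw [capFun, cap_of_lsc 𝔓 this]
  exact iSup_congr fun P => eLpNorm_enorm _

theorem capFun_bcf_lt_top (φ : PathSpace T →ᵇ ℝ) : capFun 𝔓 φ < ∞ := by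
  rw [capFun_bcf]
  refine lt_of_le_of_lt (b := ‖φ‖ₑ) (iSup_le fun P => ?_) enorm_lt_top
  refine (eLpNorm_le_of_ae_enorm_bound (C := ‖φ‖ₑ)
    (Eventually.of_forall fun ω => ?_)).trans ?_
  · rw [enorm_le_iff_norm_le]; exact φ.norm_coe_le_norm ω
  · simp

/-- A function has zero capacity exactly when it vanishes quasi-surely. -/
theorem capFun_eq_zero_iff (f : PathSpace T → ℝ) :
    capFun 𝔓 f = 0 ↔ QuasiSurely 𝔓 fun ω => f ω = 0 := by
  -- a function of zero capacity can be multiplied by `∞`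
  have key : ∀ g u : PathSpace T → ℝ≥0∞, cap 𝔓 g = 0 → (∀ ω, g ω ≠ 0 → u ω ≤ ∞ * g ω) →
      (∀ ω, g ω = 0 → u ω = 0) → cap 𝔓 u = 0 := by
    intro g u hg hu hu0
    refine le_antisymm (ENNReal.le_of_forall_pos_le_add fun ε hε _ => ?_) bot_le
    obtain ⟨δ, hδ, hδs⟩ := ENNReal.exists_pos_sum_of_countable (ε := (ε : ℝ≥0∞))
      (by simpa using hε.ne') ℕ
    have : ∀ n, ∃ v, LowerSemicontinuous v ∧ g ≤ v ∧ cap 𝔓 v < δ n := fun n =>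
      exists_lsc_of_cap_lt 𝔓 (by rw [hg]; exact_mod_cast hδ n)
    choose v hv hgv hvδ using this
    have hle : u ≤ fun ω => ∑' n, v n ω := by
      intro ω
      by_cases h : g ω = 0
      · rw [hu0 ω h]; exact bot_le
      · have : ∑' n : ℕ, v n ω = ∞ := by
          refine top_le_iff.1 ?_
          rw [← ENNReal.tsum_const_eq_top_of_ne_zero (α := ℕ) h]
          exact ENNReal.tsum_le_tsum fun n => hgv n ω
        simp [this]
    calc cap 𝔓 u ≤ cap 𝔓 fun ω => ∑' n, v n ω := cap_mono 𝔓 hle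
      _ ≤ ∑' n, cap 𝔓 (v n) := cap_tsum_le_of_lsc 𝔓 hv
      _ ≤ ∑' n, (δ n : ℝ≥0∞) := ENNReal.tsum_le_tsum fun n => (hvδ n).le
      _ ≤ 0 + ε := by rw [zero_add]; exact hδs.le
  constructor
  · intro h
    refine key _ _ h (fun ω hω => ?_) fun ω hω => ?_
    · simp [ENNReal.top_mul hω]
    · have : f ω = 0 := by simpa using hω
      simp [this]
  · intro h
    refine key _ _ h (fun ω hω => ?_) fun ω hω => ?_
    · rw [ENNReal.top_mul hω]; exact le_top
    · by_contra hne
      have : f ω ≠ 0 := by simpa using hne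
      simp [this] at hω

end Capacity

section Spaces

variable {T : ℝ} [Fact (0 ≤ T)]

/-- The functions on `Ω` which are limits, for the capacity, of bounded continuous functions. -/
def quasiSubmodule (𝔓 : Set (ProbabilityMeasure (PathSpace T))) : Submodule ℝ (PathSpace T → ℝ) where
  carrier := {f | ∀ ε : ℝ≥0∞, 0 < ε → ∃ φ : PathSpace T →ᵇ ℝ, capFun 𝔓 (f - φ) < ε}
  zero_mem' := fun ε hε => ⟨0, by
    have : (0 : PathSpace T → ℝ) - ((0 : PathSpace T →ᵇ ℝ) : PathSpace T → ℝ) = 0 := by ext; simp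
    rwa [this, capFun_zero]⟩
  add_mem' := fun {f g} hf hg ε hε => by
    obtain ⟨φ, hφ⟩ := hf (ε / 2) (ENNReal.half_pos hε.ne')
    obtain ⟨ψ, hψ⟩ := hg (ε / 2) (ENNReal.half_pos hε.ne')
    refine ⟨φ + ψ, ?_⟩
    have : f + g - ((φ + ψ : PathSpace T →ᵇ ℝ) : PathSpace T → ℝ) = (f - φ) + (g - ψ) := by
      ext; simp; ring
    rw [this, ← ENNReal.add_halves ε]
    exact (capFun_add_le 𝔓 _ _).trans_lt (ENNReal.add_lt_add hφ hψ)
  smul_mem' := fun a f hf ε hε => by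
    obtain ⟨φ, hφ⟩ := hf (ε / (‖a‖ₑ + 1)) (ENNReal.div_pos hε.ne' (by simp))
    refine ⟨a • φ, ?_⟩
    have : a • f - ((a • φ : PathSpace T →ᵇ ℝ) : PathSpace T → ℝ) = a • (f - φ) := by
      ext; simp; ring
    rw [this]
    refine (capFun_smul_le 𝔓 a _).trans_lt ?_
    have h1 := (ENNReal.lt_div_iff_mul_lt (Or.inl (by simp)) (Or.inl (by simp))).1 hφ
    refine lt_of_le_of_lt ?_ h1
    rw [mul_comm]
    exact mul_le_mul_right le_self_add _

/-- The space `ℒ`: the completion of `C_b(Ω)` for the semi-norm `c`, realised as a space of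
functions, namely the closure of `C_b(Ω)` for the extended capacity inside all functions on `Ω`.
(The extended capacity is countably subadditive, hence this closure is complete.) -/
def QuasiSpace (𝔓 : Set (ProbabilityMeasure (PathSpace T))) : Type := quasiSubmodule 𝔓

variable {𝔓 : Set (ProbabilityMeasure (PathSpace T))}

instance : AddCommGroup (QuasiSpace 𝔓) := inferInstanceAs (AddCommGroup (quasiSubmodule 𝔓))

instance : Module ℝ (QuasiSpace 𝔓) := inferInstanceAs (Module ℝ (quasiSubmodule 𝔓))

/-- The function on `Ω` underlying an element of `ℒ`. -/
def QuasiSpace.toFun (f : QuasiSpace 𝔓) : PathSpace T → ℝ := Subtype.val f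

theorem QuasiSpace.capFun_lt_top (f : QuasiSpace 𝔓) : capFun 𝔓 f.toFun < ∞ := by
  obtain ⟨φ, hφ⟩ := f.2 1 one_pos
  have : f.toFun = (f.toFun - φ) + φ := by simp
  rw [this]
  exact (capFun_add_le 𝔓 _ _).trans_lt
    (ENNReal.add_lt_top.2 ⟨hφ.trans ENNReal.one_lt_top, capFun_bcf_lt_top 𝔓 φ⟩)

/-- The semi-norm of `ℒ` is the capacity. -/
instance : SeminormedAddCommGroup (QuasiSpace 𝔓) :=
  AddGroupSeminorm.toSeminormedAddCommGroup
    { toFun := fun f => (capFun 𝔓 f.toFun).toReal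
      map_zero' := by
        change (capFun 𝔓 0).toReal = 0
        rw [capFun_zero]; rfl
      add_le' := fun f g => by
        change (capFun 𝔓 (f.toFun + g.toFun)).toReal ≤ _
        rw [← ENNReal.toReal_add f.capFun_lt_top.ne g.capFun_lt_top.ne]
        exact ENNReal.toReal_mono
          (ENNReal.add_lt_top.2 ⟨f.capFun_lt_top, g.capFun_lt_top⟩).ne (capFun_add_le 𝔓 _ _)
      neg' := fun f => by
        change (capFun 𝔓 (-f.toFun)).toReal = _
        rw [capFun_neg] }

theorem QuasiSpace.norm_def (f : QuasiSpace 𝔓) : ‖f‖ = (capFun 𝔓 f.toFun).toReal := rfl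

instance : NormedSpace ℝ (QuasiSpace 𝔓) where
  norm_smul_le := fun a f => by
    change (capFun 𝔓 (a • f.toFun)).toReal ≤ _
    rw [QuasiSpace.norm_def, ← toReal_enorm a, ← ENNReal.toReal_mul]
    exact ENNReal.toReal_mono (ENNReal.mul_lt_top enorm_lt_top f.capFun_lt_top).ne
      (capFun_smul_le 𝔓 a _)

/-- The normed space `L`: the quotient of `ℒ` by quasi-sure equality. -/
abbrev QuasiQuotient (𝔓 : Set (ProbabilityMeasure (PathSpace T))) : Type :=
  SeparationQuotient (QuasiSpace 𝔓)

/-- Two elements of `ℒ` are identified in `L` exactly when they are quasi-surely equal. -/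
theorem QuasiQuotient.mk_eq_mk_iff (f g : QuasiSpace 𝔓) :
    (SeparationQuotient.mk f : QuasiQuotient 𝔓) = SeparationQuotient.mk g ↔
      QuasiSurely 𝔓 fun ω => f.toFun ω = g.toFun ω := by
  rw [SeparationQuotient.mk_eq_mk, Metric.inseparable_iff, dist_eq_norm, QuasiSpace.norm_def,
    ENNReal.toReal_eq_zero_iff, or_iff_left (f - g).capFun_lt_top.ne, capFun_eq_zero_iff]
  have : ∀ ω, (f - g).toFun ω = 0 ↔ f.toFun ω = g.toFun ω := fun ω => sub_eq_zero
  simp_rw [this]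

end Spaces

section Elementary

/-- Indicator of an interval between two points of a monotone sequence. -/
theorem sum_indicator_Ioc {T : ℝ} (t : ℕ → TimeInt T) (ht : Monotone t) {p q n : ℕ} (hpq : p ≤ q)
    (hq : q ≤ n) (s : TimeInt T) :
    ∑ j ∈ Finset.range n, (if p ≤ j ∧ j < q then (1 : ℝ) else 0) *
      (Set.Ioc (t j) (t (j + 1))).indicator 1 s = (Set.Ioc (t p) (t q)).indicator 1 s := by
  have e : ∀ a b : TimeInt T, a ≤ b → (Set.Ioc a b).indicator (1 : TimeInt T → ℝ) s =
      (if a < s then 1 else 0) - (if b < s then 1 else 0) := by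
    intro a b hab
    by_cases h1 : a < s
    · by_cases h2 : b < s
      · simp [Set.indicator, h1, h2, not_le.2 h2]
      · simp [Set.indicator, h1, h2, not_lt.1 h2]
    · have h2 : ¬ b < s := fun h => h1 (hab.trans_lt h)
      simp [Set.indicator, h1, h2]
  have hfil : (Finset.range n).filter (fun j => p ≤ j ∧ j < q) = Finset.Ico p q := by
    ext j; simp only [Finset.mem_filter, Finset.mem_range, Finset.mem_Ico]; omega
  simp_rw [ite_mul, one_mul, zero_mul]
  rw [← Finset.sum_filter, hfil, Finset.sum_congr rfl fun j _ => e _ _ (ht j.le_succ),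
    e _ _ (ht hpq)]
  have := Finset.sum_Ico_sub (fun j => if t j < s then (1 : ℝ) else 0) hpq
  rw [← neg_inj, ← Finset.sum_neg_distrib]
  simp only [neg_sub]
  exact this

variable {T : ℝ} [Fact (0 ≤ T)]

variable (T) in
/-- The data of an elementary process: deterministic times `t 0 ≤ t 1 ≤ … ≤ t n` in `[0, T]` and
bounded continuous functions `k i`, each `𝓕 (t i)`-measurable. (Only `t 0, …, t n` and
`k 0, …, k (n - 1)` matter.) -/
structure ElemData where
  n : ℕ
  t : ℕ → TimeInt T
  monotone : Monotone t
  k : ℕ → PathSpace T →ᵇ ℝ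
  measurable : ∀ i, Measurable[canonicalFiltration T (t i)] (k i)

/-- The process `h s = ∑_{i < n} k i 1_{]t i, t (i + 1)]}(s)`. -/
def ElemData.process (d : ElemData T) (s : TimeInt T) (ω : PathSpace T) : ℝ :=
  ∑ i ∈ Finset.range d.n, d.k i ω * (Set.Ioc (d.t i) (d.t (i + 1))).indicator 1 s

/-- The elementary integral `∑_{i < n} k i (B (t (i + 1)) - B (t i))`. -/
def ElemData.integral (d : ElemData T) (ω : PathSpace T) : ℝ :=
  ∑ i ∈ Finset.range d.n, d.k i ω * (coord (d.t (i + 1)) ω - coord (d.t i) ω)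

/-- The multiples `k 1_{]a, b]}` rewritten over a finer subdivision. -/
theorem ElemData.exists_refine (d : ElemData T) (m : ℕ) (t : ℕ → TimeInt T) (ht : Monotone t)
    (hd : ∀ i, i ≤ d.n → ∃ p ≤ m, t p = d.t i) :
    ∃ k : ℕ → PathSpace T →ᵇ ℝ, (∀ i, Measurable[canonicalFiltration T (t i)] (k i)) ∧
      ∀ s ω, d.process s ω =
        ∑ j ∈ Finset.range m, k j ω * (Set.Ioc (t j) (t (j + 1))).indicator 1 s := by
  choose! p hpm hp using hd
  refine ⟨fun j => ∑ i ∈ Finset.range d.n,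
    (if p i ≤ j ∧ j < p (i + 1) then (1 : ℝ) else 0) • d.k i, fun j => ?_, fun s ω => ?_⟩
  · have : ((∑ i ∈ Finset.range d.n,
        (if p i ≤ j ∧ j < p (i + 1) then (1 : ℝ) else 0) • d.k i : PathSpace T →ᵇ ℝ) :
          PathSpace T → ℝ) = fun ω => ∑ i ∈ Finset.range d.n,
            (if p i ≤ j ∧ j < p (i + 1) then (1 : ℝ) else 0) * d.k i ω := by
      ext ω
      simp only [BoundedContinuousFunction.coe_sum, BoundedContinuousFunction.coe_smul,
        Finset.sum_apply, smul_eq_mul]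
    rw [this]
    refine Finset.measurable_fun_sum _ fun i hi => ?_
    split_ifs with h
    · have hle : d.t i ≤ t j := by
        rw [← hp i (Finset.mem_range.1 hi).le]; exact ht h.1
      exact ((d.measurable i).mono ((canonicalFiltration T).mono hle) le_rfl).const_mul _
    · simp only [zero_mul]; exact measurable_const
  · simp only [BoundedContinuousFunction.coe_sum, BoundedContinuousFunction.coe_smul,
      Finset.sum_apply, smul_eq_mul, Finset.sum_mul]
    rw [Finset.sum_comm]
    refine Finset.sum_congr rfl fun i hi => ?_
    have hi' := Finset.mem_range.1 hi
    have hmul : ∀ j, (if p i ≤ j ∧ j < p (i + 1) then (1 : ℝ) else 0) * d.k i ω *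
        (Set.Ioc (t j) (t (j + 1))).indicator 1 s = d.k i ω *
        ((if p i ≤ j ∧ j < p (i + 1) then (1 : ℝ) else 0) *
        (Set.Ioc (t j) (t (j + 1))).indicator 1 s) := fun j => by ring
    simp_rw [hmul]
    rw [← Finset.mul_sum]
    congr 1
    rw [← hp i hi'.le, ← hp (i + 1) hi']
    by_cases hle : p i ≤ p (i + 1)
    · exact (sum_indicator_Ioc t ht hle (hpm _ hi') s).symm
    · have h1 : t (p (i + 1)) ≤ t (p i) := ht (not_le.1 hle).le
      rw [Set.Ioc_eq_empty (not_lt.2 h1), Finset.sum_eq_zero]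
      · simp
      · intro j _
        rw [if_neg (by omega), zero_mul]

/-- Finitely many times can be listed by a monotone sequence. -/
theorem exists_monotone_seq (S : Finset (TimeInt T)) :
    ∃ (m : ℕ) (t : ℕ → TimeInt T), Monotone t ∧ ∀ x ∈ S, ∃ p ≤ m, t p = x := by
  rcases S.eq_empty_or_nonempty with rfl | hS
  · exact ⟨0, fun _ => ⊥, monotone_const, by simp⟩
  have hc : 0 < S.card := hS.card_pos
  let e := S.orderEmbOfFin rfl
  refine ⟨S.card, fun i => e ⟨min i (S.card - 1), by omega⟩, fun a b hab => ?_, fun x hx => ?_⟩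
  · refine e.monotone ?_
    simp only [Fin.mk_le_mk]; omega
  · have : x ∈ Set.range e := by rw [Finset.range_orderEmbOfFin]; exact hx
    obtain ⟨i, rfl⟩ := this
    refine ⟨i, i.2.le, ?_⟩
    have hi := i.2
    exact congrArg e (Fin.ext (show min (i : ℕ) (S.card - 1) = i by omega))

variable (T) in
/-- The vector space of elementary processes. -/
def elemSubmodule : Submodule ℝ (TimeInt T → PathSpace T → ℝ) where
  carrier := Set.range ElemData.process
  zero_mem' := ⟨⟨0, fun _ => ⊥, monotone_const, fun _ => 0, fun _ => measurable_const⟩, by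
    ext; simp [ElemData.process]⟩
  add_mem' := by
    classical
    rintro _ _ ⟨d, rfl⟩ ⟨d', rfl⟩
    obtain ⟨m, t, ht, hS⟩ := exists_monotone_seq
      ((Finset.range (d.n + 1)).image d.t ∪ (Finset.range (d'.n + 1)).image d'.t)
    obtain ⟨k, hk, e⟩ := d.exists_refine m t ht fun i hi => hS _ (Finset.mem_union_left _
      (Finset.mem_image_of_mem _ (Finset.mem_range.2 (by omega))))
    obtain ⟨k', hk', e'⟩ := d'.exists_refine m t ht fun i hi => hS _ (Finset.mem_union_right _
      (Finset.mem_image_of_mem _ (Finset.mem_range.2 (by omega))))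
    refine ⟨⟨m, t, ht, fun i => k i + k' i, fun i => (hk i).add (hk' i)⟩, ?_⟩
    ext s ω
    simp only [Pi.add_apply, e, e']
    simp [ElemData.process, add_mul, Finset.sum_add_distrib]
  smul_mem' := by
    rintro a _ ⟨d, rfl⟩
    refine ⟨⟨d.n, d.t, d.monotone, fun i => a • d.k i, fun i => (d.measurable i).const_smul a⟩, ?_⟩
    ext s ω
    simp [ElemData.process, Finset.mul_sum, mul_assoc]

/-- The space `ℋ_e` of elementary processes, to be endowed with the semi-norm attached to `𝔓`
and `μ`. -/
def ElemProc (_𝔓 : Set (ProbabilityMeasure (PathSpace T))) (_μ : Measure (TimeInt T)) : Type :=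
  elemSubmodule T

variable {𝔓 : Set (ProbabilityMeasure (PathSpace T))} {μ : Measure (TimeInt T)}

instance : AddCommGroup (ElemProc 𝔓 μ) := inferInstanceAs (AddCommGroup (elemSubmodule T))

instance : Module ℝ (ElemProc 𝔓 μ) := inferInstanceAs (Module ℝ (elemSubmodule T))

/-- The process underlying an element of `ℋ_e`. -/
def ElemProc.toFun (h : ElemProc 𝔓 μ) : TimeInt T → PathSpace T → ℝ := Subtype.val h

variable (𝔓 μ) in
/-- The element of `ℋ_e` with given data. -/
def ElemData.toElem (d : ElemData T) : ElemProc 𝔓 μ := ⟨d.process, d, rfl⟩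

/-- `(E_P ∫ h_s² dμ_s)^{1/2}`. -/
def energy (μ : Measure (TimeInt T)) (P : ProbabilityMeasure (PathSpace T))
    (h : TimeInt T → PathSpace T → ℝ) : ℝ :=
  √(∫ ω, ∫ s, h s ω ^ 2 ∂μ ∂(P : Measure (PathSpace T)))

theorem ElemProc.exists_bound (h : ElemProc 𝔓 μ) :
    Measurable (fun z : PathSpace T × TimeInt T => h.toFun z.2 z.1) ∧
      ∃ C : ℝ, ∀ z : PathSpace T × TimeInt T, ‖h.toFun z.2 z.1‖ ≤ C := by
  obtain ⟨_, d, rfl⟩ := h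
  change Measurable (fun z : PathSpace T × TimeInt T => d.process z.2 z.1) ∧
      ∃ C : ℝ, ∀ z : PathSpace T × TimeInt T, ‖d.process z.2 z.1‖ ≤ C
  constructor
  · refine Finset.measurable_fun_sum _ fun i _ => ?_
    exact ((d.k i).continuous.measurable.comp measurable_fst).mul
      ((measurable_one.indicator measurableSet_Ioc).comp measurable_snd)
  · refine ⟨∑ i ∈ Finset.range d.n, ‖d.k i‖, fun z => (norm_sum_le _ _).trans
      (Finset.sum_le_sum fun i _ => ?_)⟩
    rw [norm_mul]
    refine (mul_le_mul ((d.k i).norm_coe_le_norm _) (?_ : _ ≤ (1 : ℝ)) (norm_nonneg _)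
      (norm_nonneg _)).trans (mul_one _).le
    refine (norm_indicator_le_norm_self _ _).trans ?_
    simp

theorem ElemProc.memLp [IsFiniteMeasure μ] (h : ElemProc 𝔓 μ) (P : ProbabilityMeasure (PathSpace T)) :
    MemLp (fun z : PathSpace T × TimeInt T => h.toFun z.2 z.1) 2
      ((P : Measure (PathSpace T)).prod μ) := by
  obtain ⟨hm, C, hC⟩ := h.exists_bound
  exact MemLp.of_bound hm.aestronglyMeasurable C (Eventually.of_forall hC)

theorem ElemProc.energy_eq [IsFiniteMeasure μ] (h : ElemProc 𝔓 μ)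
    (P : ProbabilityMeasure (PathSpace T)) :
    energy μ P h.toFun = ‖(h.memLp P).toLp _‖ := by
  rw [Lp.norm_toLp, eLpNorm_eq_lintegral_rpow_enorm_toReal (by norm_num) (by norm_num),
    ← ENNReal.toReal_rpow, energy, Real.sqrt_eq_rpow]
  congr 1
  rw [← integral_prod (fun z : PathSpace T × TimeInt T => h.toFun z.2 z.1 ^ 2)
    (h.memLp P).integrable_sq, integral_eq_lintegral_of_nonneg_ae
    (Eventually.of_forall fun z => sq_nonneg _) (h.memLp P).integrable_sq.1]
  congr 1
  refine lintegral_congr fun z => ?_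
  rw [← Real.enorm_of_nonneg (sq_nonneg _), enorm_pow]
  simp

theorem ElemProc.bddAbove_energy [IsFiniteMeasure μ] (h : ElemProc 𝔓 μ) :
    BddAbove (Set.range fun P : 𝔓 => energy μ P.1 h.toFun) := by
  obtain ⟨hm, C, hC⟩ := h.exists_bound
  refine ⟨√(C ^ 2 * μ.real Set.univ), ?_⟩
  rintro _ ⟨P, rfl⟩
  refine Real.sqrt_le_sqrt ?_
  have h1 : ∀ ω, ∫ s, h.toFun s ω ^ 2 ∂μ ≤ C ^ 2 * μ.real Set.univ := fun ω => by
    refine (Real.le_norm_self _).trans ?_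
    refine norm_integral_le_of_norm_le_const (Eventually.of_forall fun s => ?_)
    rw [norm_pow]
    exact pow_le_pow_left₀ (norm_nonneg _) (hC (ω, s)) 2
  refine (Real.le_norm_self _).trans ?_
  refine (norm_integral_le_of_norm_le_const (C := C ^ 2 * μ.real Set.univ)
    (Eventually.of_forall fun ω => ?_)).trans (by simp)
  rw [Real.norm_of_nonneg (integral_nonneg fun s => sq_nonneg _)]
  exact h1 ω

theorem ElemProc.energy_add_le [IsFiniteMeasure μ] (h g : ElemProc 𝔓 μ)
    (P : ProbabilityMeasure (PathSpace T)) :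
    energy μ P (h + g).toFun ≤ energy μ P h.toFun + energy μ P g.toFun := by
  simp_rw [ElemProc.energy_eq]
  exact (MemLp.toLp_add (h.memLp P) (g.memLp P)) ▸ norm_add_le _ _

theorem energy_smul (a : ℝ) (h : TimeInt T → PathSpace T → ℝ) (P : ProbabilityMeasure (PathSpace T)) :
    energy μ P (a • h) = ‖a‖ * energy μ P h := by
  simp only [energy, Pi.smul_apply, smul_eq_mul, mul_pow, integral_const_mul]
  rw [Real.sqrt_mul (sq_nonneg a), Real.sqrt_sq_eq_abs, Real.norm_eq_abs]

/-- The semi-norm `‖h‖_ℋ = sup_{P ∈ 𝔓} (E_P ∫ h_s² dμ_s)^{1/2}` on elementary processes, that is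
the capacity of the bounded continuous function `(∫ h_s² dμ_s)^{1/2}`. -/
instance [IsFiniteMeasure μ] : SeminormedAddCommGroup (ElemProc 𝔓 μ) :=
  AddGroupSeminorm.toSeminormedAddCommGroup
    { toFun := fun h => ⨆ P : 𝔓, energy μ P.1 h.toFun
      map_zero' := by
        have : ∀ P : 𝔓, energy μ P.1 (0 : ElemProc 𝔓 μ).toFun = 0 := fun P => by
          change energy μ P.1 0 = 0
          simp [energy]
        simp [this]
      add_le' := fun h g => by
        refine Real.iSup_le (fun P => (ElemProc.energy_add_le h g P.1).trans (add_le_add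
          (le_ciSup h.bddAbove_energy P) (le_ciSup g.bddAbove_energy P))) ?_
        exact add_nonneg (Real.iSup_nonneg fun P => Real.sqrt_nonneg _)
          (Real.iSup_nonneg fun P => Real.sqrt_nonneg _)
      neg' := fun h => by
        refine iSup_congr fun P => ?_
        change energy μ P.1 (-h.toFun) = _
        simp [energy] }

theorem ElemProc.norm_def [IsFiniteMeasure μ] (h : ElemProc 𝔓 μ) :
    ‖h‖ = ⨆ P : 𝔓, energy μ P.1 h.toFun := rfl

instance [IsFiniteMeasure μ] : NormedSpace ℝ (ElemProc 𝔓 μ) where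
  norm_smul_le := fun a h => by
    rw [ElemProc.norm_def, ElemProc.norm_def, Real.mul_iSup_of_nonneg (norm_nonneg a)]
    refine le_of_eq (iSup_congr fun P => ?_)
    exact energy_smul a h.toFun P.1

/-- The Banach space `ℋ` (modulo processes of zero semi-norm): the completion of `ℋ_e`. -/
abbrev IntegrandSpace (𝔓 : Set (ProbabilityMeasure (PathSpace T))) (μ : Measure (TimeInt T))
    [IsFiniteMeasure μ] : Type :=
  UniformSpace.Completion (ElemProc 𝔓 μ)

end Elementary

end

end QSInt

open QSInt

/-! # The quasi-sure stochastic integral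

Fix `P ∈ 𝔓`. For `s ≤ t` and a bounded `𝓕 s`-measurable `G ≥ 0`, the local martingale `B² - ⟨B⟩`
and the bound `d⟨B⟩ ≤ dμ` give `E[G (B t - B s)²] ≤ μ(]s, t]) E[G]`
(`integral_mul_coord_sub_sq_le`). The localization is removed by Fatou's lemma alone: on the event
that the stopping time has not occurred at time `s`, the stopped process at time `s` is the process
itself (`lintegral_mul_sq_le_of_lt_localizing`). As the terms of an elementary integral are
orthogonal in `L²(P)`, this yields `‖I(h)‖_{L²(P)}² ≤ E ∫ h² dμ`
(`ElemData.integral_sum_sq_le`). Elementary integrals are continuous functions, so their capacity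
is the supremum over `P` of their `L²(P)` norms, and is at most `‖h‖_ℋ`.

Elementary integrals are unbounded, and to approximate them in `ℒ` by bounded continuous functions
one needs the squares `(B t)²` to be uniformly integrable over all of `𝔓`. By continuity of paths, a
path with `|B t| ≥ 2 N + 2` has passed near level `N` before, and must still run through half of
`|B t|`. The conditional variance bound at the first passage, together with Chebyshev's inequality
for the passage itself, shows that `E[(B t)² ; |B t| ≥ 2 N + 2] ≤ 4 C² / N²` where `C = μ(]0, t])`
(`setIntegral_coord_sq_le`). The first passage is taken along finite subdivisions whose mesh tends
to `0`. No stopping theorem in continuous time is used.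

The elementary integral is a Riemann sum of the process over any sufficiently fine subdivision,
hence depends linearly on the process alone (`ElemData.integral_eq_sum_process`). Finally `ℒ` is
complete because the capacity is countably subadditive (`cap_tsum_le`), so that the contraction
`ℋ_e → ℒ` extends to the completion.
-/

namespace QSInt

/-! ### Completeness of `ℒ` -/

section

variable {T : ℝ} [Fact (0 ≤ T)] {𝔓 : Set (ProbabilityMeasure (PathSpace T))}

theorem cap_tsum_le (g : ℕ → PathSpace T → ℝ≥0∞) :
    cap 𝔓 (fun ω => ∑' n, g n ω) ≤ ∑' n, cap 𝔓 (g n) := by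
  refine ENNReal.le_of_forall_pos_le_add fun ε hε hlt => ?_
  obtain ⟨δ, hδ, hδs⟩ := ENNReal.exists_pos_sum_of_countable (ε := (ε : ℝ≥0∞))
    (by simpa using hε.ne') ℕ
  have : ∀ n, ∃ v, LowerSemicontinuous v ∧ g n ≤ v ∧ cap 𝔓 v < cap 𝔓 (g n) + δ n := fun n =>
    exists_lsc_of_cap_lt 𝔓 (ENNReal.lt_add_right (ENNReal.ne_top_of_tsum_ne_top hlt.ne n)
      (by simpa using (hδ n).ne'))
  choose v hv hgv hvδ using this
  calc cap 𝔓 (fun ω => ∑' n, g n ω)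
      ≤ cap 𝔓 fun ω => ∑' n, v n ω := cap_mono 𝔓 fun ω => ENNReal.tsum_le_tsum fun n => hgv n ω
    _ ≤ ∑' n, cap 𝔓 (v n) := cap_tsum_le_of_lsc 𝔓 hv
    _ ≤ ∑' n, (cap 𝔓 (g n) + δ n) := ENNReal.tsum_le_tsum fun n => (hvδ n).le
    _ ≤ ∑' n, cap 𝔓 (g n) + ε := by rw [ENNReal.tsum_add]; gcongr

/-- A sequence whose successive differences have summable capacities converges for the capacity.
The limit is the pointwise one where the differences are absolutely summable, and `0` elsewhere:
there the majorant `∑ |f (k + 1) - f k|` is infinite, so the choice of the value is harmless. -/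
theorem exists_capFun_sub_le (f : ℕ → PathSpace T → ℝ) :
    ∃ g : PathSpace T → ℝ, ∀ n,
      capFun 𝔓 (g - f n) ≤ ∑' k, capFun 𝔓 (f (n + k + 1) - f (n + k)) := by
  have hlim : ∀ ω, ∃ y : ℝ, (∑' k, ‖f (k + 1) ω - f k ω‖ₑ) ≠ ∞ →
      Tendsto (fun n => f n ω) atTop (𝓝 y) := by
    intro ω
    by_cases h : (∑' k, ‖f (k + 1) ω - f k ω‖ₑ) ≠ ∞
    · have hc : CauchySeq fun n => f n ω := by
        refine cauchySeq_of_edist_le_of_tsum_ne_top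
          (fun k => ‖f (k + 1) ω - f k ω‖ₑ) (fun k => ?_) h
        rw [edist_comm, edist_eq_enorm_sub]
      obtain ⟨y, hy⟩ := cauchySeq_tendsto_of_complete hc
      exact ⟨y, fun _ => hy⟩
    · exact ⟨0, fun h' => absurd h' h⟩
  choose g hg using hlim
  refine ⟨g, fun n => ?_⟩
  refine (cap_mono 𝔓 fun ω => ?_).trans (cap_tsum_le (𝔓 := 𝔓)
    fun k ω => ‖(f (n + k + 1) - f (n + k)) ω‖ₑ)
  by_cases h : (∑' k, ‖f (k + 1) ω - f k ω‖ₑ) ≠ ∞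
  · have := edist_le_tsum_of_edist_le_of_tendsto (fun k => ‖f (k + 1) ω - f k ω‖ₑ)
      (fun k => by rw [edist_comm, edist_eq_enorm_sub]) (hg ω h) n
    rw [edist_comm, edist_eq_enorm_sub] at this
    exact this
  · have h1 : ∑' k, ‖f (n + k + 1) ω - f (n + k) ω‖ₑ = ∞ := by
      by_contra hne
      refine h ?_
      rw [← (ENNReal.summable
        (f := fun k => ‖f (k + n + 1) ω - f (k + n) ω‖ₑ)).sum_add_tsum_nat_add'
        (f := fun k => ‖f (k + 1) ω - f k ω‖ₑ)]
      refine ENNReal.add_ne_top.2 ⟨ENNReal.sum_ne_top.2 fun k _ => enorm_ne_top, ?_⟩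
      simpa only [add_comm _ n] using hne
    simp only [Pi.sub_apply, h1]
    exact le_top

instance : CompleteSpace (QuasiSpace 𝔓) := by
  refine Metric.complete_of_convergent_controlled_sequences (fun n => (1 / 2) ^ n)
    (fun n => by positivity) fun u hu => ?_
  obtain ⟨g, hg⟩ := exists_capFun_sub_le (𝔓 := 𝔓) fun n => (u n).toFun
  have hstep : ∀ n, capFun 𝔓 ((u (n + 1)).toFun - (u n).toFun) ≤ ENNReal.ofReal ((1 / 2) ^ n) := by
    intro n
    have h := (hu n (n + 1) n n.le_succ le_rfl).le
    rw [dist_eq_norm, QuasiSpace.norm_def] at h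
    exact (ENNReal.le_ofReal_iff_toReal_le (u (n + 1) - u n).capFun_lt_top.ne (by positivity)).2 h
  have hle : ∀ n, capFun 𝔓 (g - (u n).toFun) ≤ ENNReal.ofReal (2 * (1 / 2) ^ n) := by
    intro n
    refine (hg n).trans ((ENNReal.tsum_le_tsum fun k => hstep (n + k)).trans ?_)
    have hs : HasSum (fun k : ℕ => (1 / 2 : ℝ) ^ (n + k)) (2 * (1 / 2) ^ n) := by
      simpa [pow_add, mul_comm] using hasSum_geometric_two.mul_left ((1 / 2 : ℝ) ^ n)
    rw [← ENNReal.ofReal_tsum_of_nonneg (fun k => by positivity) hs.summable, hs.tsum_eq]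
  have h0 : Tendsto (fun n : ℕ => 2 * (1 / 2 : ℝ) ^ n) atTop (𝓝 0) := by
    simpa using (tendsto_pow_atTop_nhds_zero_of_lt_one (r := (1 / 2 : ℝ)) (by norm_num)
      (by norm_num)).const_mul 2
  have h0' : Tendsto (fun n : ℕ => ENNReal.ofReal (2 * (1 / 2 : ℝ) ^ n)) atTop (𝓝 0) := by
    simpa using ENNReal.tendsto_ofReal h0
  have hmem : g ∈ quasiSubmodule 𝔓 := by
    intro ε hε
    obtain ⟨n, hn⟩ := (h0'.eventually_lt_const (ENNReal.half_pos hε.ne')).exists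
    obtain ⟨φ, hφ⟩ := (u n).2 (ε / 2) (ENNReal.half_pos hε.ne')
    refine ⟨φ, ?_⟩
    have e : g - (φ : PathSpace T → ℝ) = (g - (u n).toFun) + ((u n).toFun - φ) := by simp
    rw [e, ← ENNReal.add_halves ε]
    exact (capFun_add_le 𝔓 _ _).trans_lt (ENNReal.add_lt_add ((hle n).trans_lt hn) hφ)
  let g' : QuasiSpace 𝔓 := ⟨g, hmem⟩
  refine ⟨g', tendsto_iff_dist_tendsto_zero.2 ?_⟩
  refine squeeze_zero (fun n => dist_nonneg) (fun n => ?_) h0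
  rw [dist_comm, dist_eq_norm, QuasiSpace.norm_def]
  exact ENNReal.toReal_le_of_le_ofReal (by positivity) (hle n)

end

/-! ### The elementary integral depends only on the process -/

section

theorem sum_indicator_mul_sub {T : ℝ} (x : TimeInt T → ℝ) {u : ℕ → TimeInt T} (hu : Monotone u)
    {p q m : ℕ} (hpq : u p ≤ u q) (hq : q ≤ m) :
    ∑ j ∈ Finset.range m, (Set.Ioc (u p) (u q)).indicator (1 : TimeInt T → ℝ) (u (j + 1)) *
      (x (u (j + 1)) - x (u j)) = x (u q) - x (u p) := by
  rcases le_or_gt p q with hle | hlt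
  · have hfil : (Finset.range m).filter (fun j => p ≤ j ∧ j < q) = Finset.Ico p q := by
      ext j; simp only [Finset.mem_filter, Finset.mem_range, Finset.mem_Ico]; omega
    rw [← Finset.sum_Ico_sub (fun j => x (u j)) hle, ← hfil, Finset.sum_filter]
    refine Finset.sum_congr rfl fun j _ => ?_
    -- both sides vanish when `u (j + 1) = u j`, so only strict increments matter
    rcases (hu j.le_succ).eq_or_lt with he | hs
    · simp [he]
    · by_cases h : p ≤ j ∧ j < q
      · have : u (j + 1) ∈ Set.Ioc (u p) (u q) := ⟨(hu h.1).trans_lt hs, hu h.2⟩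
        rw [if_pos h, Set.indicator_of_mem this]; simp
      · have : u (j + 1) ∉ Set.Ioc (u p) (u q) := fun hmem => h
          ⟨by by_contra hj; exact absurd (hu (by omega : j + 1 ≤ p)) (not_le.2 hmem.1),
            by by_contra hj; exact absurd ((hu (not_lt.1 hj)).trans_lt hs) (not_lt.2 hmem.2)⟩
        rw [if_neg h, Set.indicator_of_notMem this, zero_mul]
  · have he : u p = u q := le_antisymm hpq (hu hlt.le)
    simp [he]

variable {T : ℝ} [Fact (0 ≤ T)]

/-- The elementary integral as a Riemann sum of the process alone, over any subdivision which
contains the times of the data. -/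
theorem ElemData.integral_eq_sum_process (d : ElemData T) {u : ℕ → TimeInt T} (hu : Monotone u)
    {m : ℕ} (hd : ∀ i, i ≤ d.n → ∃ p ≤ m, u p = d.t i) (ω : PathSpace T) :
    d.integral ω = ∑ j ∈ Finset.range m,
      d.process (u (j + 1)) ω * (coord (u (j + 1)) ω - coord (u j) ω) := by
  choose! p hpm hp using hd
  simp only [ElemData.process, ElemData.integral, Finset.sum_mul]
  rw [Finset.sum_comm]
  refine Finset.sum_congr rfl fun i hi => ?_
  have hi' := Finset.mem_range.1 hi
  have hle := d.monotone i.le_succ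
  rw [← hp i hi'.le, ← hp (i + 1) hi'] at hle ⊢
  rw [← sum_indicator_mul_sub (fun t => coord t ω) hu hle (hpm _ hi'), Finset.mul_sum]
  exact Finset.sum_congr rfl fun j _ => by ring

theorem ElemData.integral_eq_of_process_eq (a : ℝ) (d d' e : ElemData T)
    (h : e.process = a • d.process + d'.process) : e.integral = a • d.integral + d'.integral := by
  classical
  obtain ⟨m, u, hu, hS⟩ := exists_monotone_seq
    ((Finset.range (d.n + 1)).image d.t ∪ (Finset.range (d'.n + 1)).image d'.t ∪
      (Finset.range (e.n + 1)).image e.t)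
  have h1 : ∀ i, i ≤ d.n → ∃ p ≤ m, u p = d.t i := fun i hi => hS _ <| by
    simp only [Finset.mem_union, Finset.mem_image, Finset.mem_range]
    exact Or.inl (Or.inl ⟨i, by omega, rfl⟩)
  have h2 : ∀ i, i ≤ d'.n → ∃ p ≤ m, u p = d'.t i := fun i hi => hS _ <| by
    simp only [Finset.mem_union, Finset.mem_image, Finset.mem_range]
    exact Or.inl (Or.inr ⟨i, by omega, rfl⟩)
  have h3 : ∀ i, i ≤ e.n → ∃ p ≤ m, u p = e.t i := fun i hi => hS _ <| by
    simp only [Finset.mem_union, Finset.mem_image, Finset.mem_range]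
    exact Or.inr ⟨i, by omega, rfl⟩
  ext ω
  simp only [Pi.add_apply, Pi.smul_apply, smul_eq_mul]
  rw [d.integral_eq_sum_process hu h1, d'.integral_eq_sum_process hu h2,
    e.integral_eq_sum_process hu h3, Finset.mul_sum, ← Finset.sum_add_distrib, h]
  refine Finset.sum_congr rfl fun j _ => ?_
  simp only [Pi.add_apply, Pi.smul_apply, smul_eq_mul]
  ring

end

/-! ### Conditional variance of the coordinate process -/

section

theorem integral_mul_eq_of_martingale {Ω ι : Type*} [Preorder ι] {m0 : MeasurableSpace Ω}
    {P : Measure Ω} [IsFiniteMeasure P] {ℱ : Filtration ι m0} {M : ι → Ω → ℝ}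
    (hM : Martingale M ℱ P) {s t : ι} (hst : s ≤ t) {G : Ω → ℝ}
    (hG : StronglyMeasurable[ℱ s] G) (hint : Integrable (fun ω => G ω * M t ω) P) :
    ∫ ω, G ω * M t ω ∂P = ∫ ω, G ω * M s ω ∂P := by
  have h1 := condExp_mul_of_stronglyMeasurable_left hG hint (hM.integrable t)
  rw [← integral_condExp (ℱ.le s)]
  refine integral_congr_ae (h1.trans ?_)
  filter_upwards [hM.condExp_ae_eq hst] with ω hω
  simp [hω]

theorem exists_untopA_min_eq {ι : Type*} [LinearOrder ι] [Nonempty ι] {s t : ι} (hst : s ≤ t)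
    {x : WithTop ι} (hx : (s : WithTop ι) < x) :
    ∃ r, s ≤ r ∧ r ≤ t ∧ (min (t : WithTop ι) x).untopA = r := by
  induction x with
  | top => exact ⟨t, hst, le_rfl, by simp⟩
  | coe x =>
    refine ⟨min t x, le_min hst (WithTop.coe_lt_coe.1 hx).le, min_le_left _ _, ?_⟩
    rw [← WithTop.coe_min, WithTop.untopA_eq_untop (by simp), WithTop.untop_coe]

variable {T : ℝ} [Fact (0 ≤ T)] {μ : Measure (TimeInt T)} {P : ProbabilityMeasure (PathSpace T)}

/-- The comparison of `B² - ⟨B⟩` at the times `s ≤ t`, weighted by a function `H` which vanishes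
unless every stopping time of the localizing sequence exceeds `s`. Under this restriction the
stopped process at time `s` is the process itself, so that Fatou's lemma suffices and no maximal
inequality is needed to remove the localization at time `t`. -/
theorem lintegral_mul_sq_le_of_lt_localizing {A : TimeInt T → PathSpace T → ℝ}
    (hA : IsQuadraticVariation P A)
    (hAμ : ∀ᵐ ω ∂(P : Measure (PathSpace T)), Monotone fun t => distFun μ t - A t ω)
    {τ : ℕ → PathSpace T → WithTop (TimeInt T)}
    (hτ : ∀ᵐ ω ∂(P : Measure (PathSpace T)), Tendsto (τ · ω) atTop (𝓝 ⊤))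
    (hmart : ∀ n, Martingale (stoppedProcess (fun i ↦ {ω | ⊥ < τ n ω}.indicator
      fun ω => coord i ω ^ 2 - A i ω) (τ n)) (canonicalFiltration T) (P : Measure (PathSpace T)))
    {s t : TimeInt T} (hst : s ≤ t) {H : PathSpace T → ℝ}
    (hH : StronglyMeasurable[canonicalFiltration T s] H) (h0 : 0 ≤ H) {C : ℝ} (hC : ∀ ω, H ω ≤ C)
    (hHτ : ∀ᵐ ω ∂(P : Measure (PathSpace T)), ∀ n, H ω ≠ 0 → s < τ n ω) :
    ∫⁻ ω, ENNReal.ofReal (H ω * coord t ω ^ 2) ∂(P : Measure (PathSpace T)) ≤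
      ∫⁻ ω, ENNReal.ofReal (H ω * (coord s ω ^ 2 + (distFun μ t - distFun μ s)))
        ∂(P : Measure (PathSpace T)) := by
  set c := distFun μ t - distFun μ s
  set M : ℕ → TimeInt T → PathSpace T → ℝ := fun n =>
    stoppedProcess (fun i ↦ {ω | ⊥ < τ n ω}.indicator fun ω => coord i ω ^ 2 - A i ω) (τ n)
  have hHm : StronglyMeasurable H := hH.mono ((canonicalFiltration T).le s)
  have hHb : ∀ ω, ‖H ω‖ ≤ C := fun ω => by rw [Real.norm_of_nonneg (h0 ω)]; exact hC ω
  have hM : ∀ n r ω, s ≤ r → s < τ n ω → ∃ q, s ≤ q ∧ q ≤ r ∧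
      M n r ω = coord q ω ^ 2 - A q ω := by
    intro n r ω hr hs
    obtain ⟨q, h1, h2, h3⟩ := exists_untopA_min_eq hr hs
    refine ⟨q, h1, h2, ?_⟩
    have hb : ω ∈ {ω | ⊥ < τ n ω} := lt_of_le_of_lt bot_le hs
    simp only [M, stoppedProcess, h3]
    exact Set.indicator_of_mem hb _
  have hAs : Integrable (fun ω => H ω * (A s ω + c)) (P : Measure (PathSpace T)) := by
    refine Integrable.bdd_mul (Integrable.add ?_ (integrable_const c))
      hHm.aestronglyMeasurable (Eventually.of_forall hHb)
    refine Integrable.of_bound ((hA.adapted s).mono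
      ((canonicalFiltration T).le s)).aestronglyMeasurable (distFun μ s - distFun μ ⊥) ?_
    filter_upwards [hA.zero, hA.monotone, hAμ] with ω hz hm hm'
    have h1 := hm (bot_le : ⊥ ≤ s)
    have h2 := hm' (bot_le : ⊥ ≤ s)
    simp only [hz] at h1 h2
    rw [Real.norm_of_nonneg h1]; linarith
  have hMi : ∀ n r, Integrable (fun ω => H ω * M n r ω) (P : Measure (PathSpace T)) := fun n r =>
    ((hmart n).integrable r).bdd_mul hHm.aestronglyMeasurable (Eventually.of_forall hHb)
  -- the measurable nonnegative majorant of the stopped square: the stopped bracket is at most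
  -- `A s + c` before time `t`, and need not itself be measurable
  set Y : ℕ → PathSpace T → ℝ := fun n ω => H ω * M n t ω + H ω * (A s ω + c)
  have hYi : ∀ n, Integrable (Y n) (P : Measure (PathSpace T)) := fun n => (hMi n t).add hAs
  have hY0 : ∀ n, 0 ≤ᵐ[(P : Measure (PathSpace T))] Y n := by
    intro n
    filter_upwards [hHτ, hAμ, hA.monotone] with ω hω hm hmA
    change 0 ≤ H ω * M n t ω + H ω * (A s ω + c)
    by_cases hz : H ω = 0
    · simp [hz]
    · obtain ⟨q, h1, h2, h3⟩ := hM n t ω hst (hω n hz)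
      rw [h3, ← mul_add]
      have h4 := hm h1
      have h5 := hm h2
      have h6 := hmA h2
      simp only at h4 h5 h6
      exact mul_nonneg (h0 ω) (by linarith [sq_nonneg (coord q ω)])
  have hYint : ∀ n, ∫⁻ ω, ENNReal.ofReal (Y n ω) ∂(P : Measure (PathSpace T)) =
      ∫⁻ ω, ENNReal.ofReal (H ω * (coord s ω ^ 2 + c)) ∂(P : Measure (PathSpace T)) := by
    intro n
    have e : (fun ω => H ω * M n s ω + H ω * (A s ω + c)) =ᵐ[(P : Measure (PathSpace T))]
        fun ω => H ω * (coord s ω ^ 2 + c) := by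
      filter_upwards [hHτ] with ω hω
      by_cases hz : H ω = 0
      · simp [hz]
      · obtain ⟨q, h1, h2, h3⟩ := hM n s ω le_rfl (hω n hz)
        rw [h3, le_antisymm h2 h1]; ring
    have hint := ((hMi n s).add hAs).congr e
    have hc0 : 0 ≤ᵐ[(P : Measure (PathSpace T))] fun ω => H ω * (coord s ω ^ 2 + c) := by
      filter_upwards [e, hHτ, hA.monotone, hAμ] with ω _ _ hm hm'
      have h1 := hm hst
      have h2 := hm' hst
      simp only at h1 h2
      exact mul_nonneg (h0 ω) (add_nonneg (sq_nonneg _) (by linarith))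
    rw [← ofReal_integral_eq_lintegral_ofReal (hYi n) (hY0 n),
      ← ofReal_integral_eq_lintegral_ofReal hint hc0, ← integral_congr_ae e,
      integral_add (hMi n t) hAs, integral_add (hMi n s) hAs,
      integral_mul_eq_of_martingale (hmart n) hst hH (hMi n t)]
  calc ∫⁻ ω, ENNReal.ofReal (H ω * coord t ω ^ 2) ∂(P : Measure (PathSpace T))
      ≤ ∫⁻ ω, liminf (fun n => ENNReal.ofReal (Y n ω)) atTop ∂(P : Measure (PathSpace T)) := by
        refine lintegral_mono_ae ?_
        filter_upwards [hτ, hAμ] with ω hω hm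
        refine le_liminf_of_le (by isBoundedDefault) ?_
        filter_upwards [(WithTop.tendsto_nhds_top_iff _).1 hω t] with n hn
        refine ENNReal.ofReal_le_ofReal ?_
        obtain ⟨q, h1, h2, h3⟩ := exists_untopA_min_eq (le_refl t) hn
        have hb : ω ∈ {ω | ⊥ < τ n ω} := lt_of_le_of_lt bot_le hn
        have h4 : M n t ω = coord t ω ^ 2 - A t ω := by
          simp only [M, stoppedProcess, h3, le_antisymm h2 h1]
          exact Set.indicator_of_mem hb _
        simp only [Y, h4, ← mul_add]
        have h5 := hm hst
        simp only at h5
        exact mul_le_mul_of_nonneg_left (by linarith) (h0 ω)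
    _ ≤ liminf (fun n => ∫⁻ ω, ENNReal.ofReal (Y n ω) ∂(P : Measure (PathSpace T))) atTop :=
        lintegral_liminf_le' fun n => (hYi n).1.aemeasurable.ennreal_ofReal
    _ = _ := by simp only [hYint, liminf_const]

/-- The conditional variance bound in weak form, `E[G (B t)²] ≤ E[G ((B s)² + μ(]s, t]))]`, before
the integrability of `(B t)²` is known. -/
theorem BracketLE.lintegral_mul_sq_le (h : BracketLE μ P) {s t : TimeInt T} (hst : s ≤ t)
    {G : PathSpace T → ℝ} (hG : StronglyMeasurable[canonicalFiltration T s] G) (h0 : 0 ≤ G)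
    {C : ℝ} (hC : ∀ ω, G ω ≤ C) :
    ∫⁻ ω, ENNReal.ofReal (G ω * coord t ω ^ 2) ∂(P : Measure (PathSpace T)) ≤
      ∫⁻ ω, ENNReal.ofReal (G ω * (coord s ω ^ 2 + (distFun μ t - distFun μ s)))
        ∂(P : Measure (PathSpace T)) := by
  obtain ⟨A, hA, hAμ⟩ := h
  obtain ⟨τ, hτ, hmart⟩ := hA.localMartingale
  set c := distFun μ t - distFun μ s
  set H : ℕ → PathSpace T → ℝ := fun m => {ω | s < τ m ω}.indicator G
  have hH : ∀ m, StronglyMeasurable[canonicalFiltration T s] (H m) := fun m =>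
    hG.indicator ((hτ.isStoppingTime m).measurableSet_gt s)
  have hH0 : ∀ m, 0 ≤ H m := fun m => Set.indicator_nonneg fun ω _ => h0 ω
  have hHG : ∀ m ω, H m ω ≤ G ω := fun m ω => Set.indicator_le_self' (fun ω _ => h0 ω) ω
  have hc0 : ∀ᵐ ω ∂(P : Measure (PathSpace T)), 0 ≤ c := by
    filter_upwards [hA.monotone, hAμ] with ω hm hm'
    have h1 := hm hst
    have h2 := hm' hst
    simp only at h1 h2
    linarith
  have hm : ∀ m, ∫⁻ ω, ENNReal.ofReal (H m ω * coord t ω ^ 2) ∂(P : Measure (PathSpace T)) ≤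
      ∫⁻ ω, ENNReal.ofReal (G ω * (coord s ω ^ 2 + c)) ∂(P : Measure (PathSpace T)) := by
    intro m
    refine (lintegral_mul_sq_le_of_lt_localizing hA hAμ (τ := fun n => τ (n + m)) ?_
      (fun n => hmart (n + m)) hst (hH m) (hH0 m) (fun ω => (hHG m ω).trans (hC ω)) ?_).trans ?_
    · filter_upwards [hτ.tendsto_top] with ω hω using hω.comp (tendsto_add_atTop_nat m)
    · filter_upwards [hτ.mono] with ω hω n hne
      have : ω ∈ {ω | (s : WithTop (TimeInt T)) < τ m ω} := Set.mem_of_indicator_ne_zero hne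
      exact lt_of_lt_of_le this (hω (Nat.le_add_left m n))
    · refine lintegral_mono_ae ?_
      filter_upwards [hc0] with ω hω
      exact ENNReal.ofReal_le_ofReal
        (mul_le_mul_of_nonneg_right (hHG m ω) (add_nonneg (sq_nonneg _) hω))
  calc ∫⁻ ω, ENNReal.ofReal (G ω * coord t ω ^ 2) ∂(P : Measure (PathSpace T))
      ≤ ∫⁻ ω, liminf (fun m => ENNReal.ofReal (H m ω * coord t ω ^ 2)) atTop
          ∂(P : Measure (PathSpace T)) := by
        refine lintegral_mono_ae ?_
        filter_upwards [hτ.tendsto_top] with ω hω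
        refine le_liminf_of_le (by isBoundedDefault) ?_
        filter_upwards [(WithTop.tendsto_nhds_top_iff _).1 hω s] with m hn
        have : ω ∈ {ω | (s : WithTop (TimeInt T)) < τ m ω} := hn
        simp only [H, Set.indicator_of_mem this, le_refl]
    _ ≤ liminf (fun m => ∫⁻ ω, ENNReal.ofReal (H m ω * coord t ω ^ 2)
          ∂(P : Measure (PathSpace T))) atTop :=
        lintegral_liminf_le' fun m => (((hH m).mono ((canonicalFiltration T).le s)).measurable.mul
          ((continuous_coord t).measurable.pow_const 2)).ennreal_ofReal.aemeasurable
    _ ≤ _ := (liminf_le_liminf (Eventually.of_forall hm)).trans (by simp)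

end

section

variable {T : ℝ} [Fact (0 ≤ T)] {μ : Measure (TimeInt T)} {P : ProbabilityMeasure (PathSpace T)}

theorem coord_bot (ω : PathSpace T) : coord ⊥ ω = 0 := ω.2

theorem BracketLE.distFun_mono (h : BracketLE μ P) : Monotone (distFun μ) := by
  obtain ⟨A, hA, hAμ⟩ := h
  obtain ⟨ω, hm, hm'⟩ := (hA.monotone.and hAμ).exists
  intro s t hst
  have h1 := hm hst
  have h2 := hm' hst
  simp only at h1 h2
  linarith

theorem BracketLE.memLp_coord (h : BracketLE μ P) (t : TimeInt T) :
    MemLp (coord t) 2 (P : Measure (PathSpace T)) := by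
  have hm := (continuous_coord t).measurable
  refine (memLp_two_iff_integrable_sq hm.aestronglyMeasurable).2
    ⟨(hm.pow_const 2).aestronglyMeasurable, ?_⟩
  rw [hasFiniteIntegral_iff_ofReal (Eventually.of_forall fun ω => sq_nonneg _)]
  have := h.lintegral_mul_sq_le (bot_le : ⊥ ≤ t) (G := fun _ => 1) stronglyMeasurable_const
    (fun _ => zero_le_one) (C := 1) (fun _ => le_rfl)
  simp only [one_mul, coord_bot, lintegral_const] at this
  exact this.trans_lt (ENNReal.mul_lt_top ENNReal.ofReal_lt_top (measure_lt_top _ _))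

theorem integrable_mul_mul_of_bound {Ω : Type*} {m : MeasurableSpace Ω} {P : Measure Ω}
    {G X Y : Ω → ℝ} (hG : AEStronglyMeasurable G P) {C : ℝ} (hC : ∀ ω, ‖G ω‖ ≤ C)
    (hX : MemLp X 2 P) (hY : MemLp Y 2 P) : Integrable (fun ω => G ω * (X ω * Y ω)) P :=
  (hX.integrable_mul hY).bdd_mul hG (Eventually.of_forall hC)

/-- Pythagoras for the increments of the coordinate process, weighted by a bounded function
measurable at the initial time. -/
theorem integral_mul_coord_sub_sq (hP : IsMartingaleMeasure P) (hμ : BracketLE μ P)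
    {s t : TimeInt T} (hst : s ≤ t) {G : PathSpace T → ℝ}
    (hG : StronglyMeasurable[canonicalFiltration T s] G) {C : ℝ} (hC : ∀ ω, ‖G ω‖ ≤ C) :
    ∫ ω, G ω * (coord t ω - coord s ω) ^ 2 ∂(P : Measure (PathSpace T)) =
      ∫ ω, G ω * coord t ω ^ 2 ∂(P : Measure (PathSpace T)) -
        ∫ ω, G ω * coord s ω ^ 2 ∂(P : Measure (PathSpace T)) := by
  have hGm := (hG.mono ((canonicalFiltration T).le s)).aestronglyMeasurable
    (μ := (P : Measure (PathSpace T)))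
  have hi : ∀ q r : TimeInt T, Integrable (fun ω => G ω * (coord q ω * coord r ω))
      (P : Measure (PathSpace T)) := fun q r =>
    integrable_mul_mul_of_bound hGm hC (hμ.memLp_coord q) (hμ.memLp_coord r)
  have hcross : ∫ ω, G ω * (coord s ω * coord t ω) ∂(P : Measure (PathSpace T)) =
      ∫ ω, G ω * (coord s ω * coord s ω) ∂(P : Measure (PathSpace T)) := by
    simp_rw [← mul_assoc]
    exact integral_mul_eq_of_martingale hP hst (G := fun ω => G ω * coord s ω)
      (hG.mul (hP.1 s)) (by simpa only [← mul_assoc] using hi s t)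
  have e : ∀ ω, G ω * (coord t ω - coord s ω) ^ 2 = G ω * (coord t ω * coord t ω) -
      2 * (G ω * (coord s ω * coord t ω)) + G ω * (coord s ω * coord s ω) := fun ω => by ring
  simp_rw [e, pow_two]
  rw [integral_add (f := fun ω => _ - _) ((hi t t).sub ((hi s t).const_mul 2)) (hi s s),
    integral_sub (hi t t) ((hi s t).const_mul 2), integral_const_mul, hcross]
  ring

/-- The conditional variance of an increment of `B` is at most the `μ`-mass of the interval. -/
theorem integral_mul_coord_sub_sq_le (hP : IsMartingaleMeasure P) (hμ : BracketLE μ P)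
    {s t : TimeInt T} (hst : s ≤ t) {G : PathSpace T → ℝ}
    (hG : StronglyMeasurable[canonicalFiltration T s] G) (h0 : 0 ≤ G) {C : ℝ}
    (hC : ∀ ω, G ω ≤ C) :
    ∫ ω, G ω * (coord t ω - coord s ω) ^ 2 ∂(P : Measure (PathSpace T)) ≤
      (distFun μ t - distFun μ s) * ∫ ω, G ω ∂(P : Measure (PathSpace T)) := by
  have hGm := (hG.mono ((canonicalFiltration T).le s)).aestronglyMeasurable
    (μ := (P : Measure (PathSpace T)))
  have hC' : ∀ ω, ‖G ω‖ ≤ C := fun ω => by rw [Real.norm_of_nonneg (h0 ω)]; exact hC ω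
  have hi : ∀ r : TimeInt T, Integrable (fun ω => G ω * coord r ω ^ 2)
      (P : Measure (PathSpace T)) := fun r => by
    simpa only [pow_two] using
      integrable_mul_mul_of_bound hGm hC' (hμ.memLp_coord r) (hμ.memLp_coord r)
  have hGi : Integrable (fun ω => G ω * (distFun μ t - distFun μ s))
      (P : Measure (PathSpace T)) :=
    (Integrable.of_bound hGm C (Eventually.of_forall hC')).mul_const _
  rw [integral_mul_coord_sub_sq hP hμ hst hG hC', sub_le_iff_le_add, mul_comm,
    ← integral_mul_const, ← integral_add hGi (hi s)]
  have hd := hμ.distFun_mono hst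
  have key := hμ.lintegral_mul_sq_le hst hG h0 hC
  rw [← ofReal_integral_eq_lintegral_ofReal (hi t)
    (Eventually.of_forall fun ω => mul_nonneg (h0 ω) (sq_nonneg _))] at key
  simp_rw [mul_add, add_comm (G _ * coord s _ ^ 2)] at key
  have hnn : ∀ ω, 0 ≤ G ω * (distFun μ t - distFun μ s) + G ω * coord s ω ^ 2 := fun ω =>
    add_nonneg (mul_nonneg (h0 ω) (by linarith)) (mul_nonneg (h0 ω) (sq_nonneg _))
  rw [← ofReal_integral_eq_lintegral_ofReal (f := fun ω => _ + _) (hGi.add (hi s))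
    (Eventually.of_forall hnn)] at key
  exact (ENNReal.ofReal_le_ofReal_iff (integral_nonneg hnn)).1 key

theorem setIntegral_coord_sub_sq_le (hP : IsMartingaleMeasure P) (hμ : BracketLE μ P)
    {s t : TimeInt T} (hst : s ≤ t) {D : Set (PathSpace T)}
    (hD : MeasurableSet[canonicalFiltration T s] D) :
    ∫ ω in D, (coord t ω - coord s ω) ^ 2 ∂(P : Measure (PathSpace T)) ≤
      (distFun μ t - distFun μ s) * (P : Measure (PathSpace T)).real D := by
  have hD' := (canonicalFiltration T).le s _ hD
  have := integral_mul_coord_sub_sq_le hP hμ hst (G := D.indicator 1)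
    (stronglyMeasurable_one.indicator hD) (Set.indicator_nonneg fun _ _ => zero_le_one) (C := 1)
    (Set.indicator_le_self' (fun _ _ => zero_le_one))
  rw [← integral_indicator hD']
  refine le_trans (le_of_eq (integral_congr_ae (Eventually.of_forall fun ω => ?_)))
    (this.trans_eq ?_)
  · by_cases h : ω ∈ D <;> simp [h]
  · rw [integral_indicator_one hD']

theorem setIntegral_coord_sq_mono (hP : IsMartingaleMeasure P) (hμ : BracketLE μ P)
    {s t : TimeInt T} (hst : s ≤ t) {D : Set (PathSpace T)}
    (hD : MeasurableSet[canonicalFiltration T s] D) :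
    ∫ ω in D, coord s ω ^ 2 ∂(P : Measure (PathSpace T)) ≤
      ∫ ω in D, coord t ω ^ 2 ∂(P : Measure (PathSpace T)) := by
  have hD' := (canonicalFiltration T).le s _ hD
  have := integral_mul_coord_sub_sq hP hμ hst (G := D.indicator 1)
    (stronglyMeasurable_one.indicator hD) (C := 1)
    (fun ω => (norm_indicator_le_norm_self _ _).trans (by simp))
  have h0 : 0 ≤ ∫ ω, D.indicator 1 ω * (coord t ω - coord s ω) ^ 2 ∂(P : Measure (PathSpace T)) :=
    integral_nonneg fun ω =>
      mul_nonneg (Set.indicator_nonneg (fun _ _ => zero_le_one) ω) (sq_nonneg _)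
  have e : ∀ f : PathSpace T → ℝ, ∫ ω in D, f ω ∂(P : Measure (PathSpace T)) =
      ∫ ω, D.indicator 1 ω * f ω ∂(P : Measure (PathSpace T)) := fun f => by
    rw [← integral_indicator hD']
    refine integral_congr_ae (Eventually.of_forall fun ω => ?_)
    by_cases h : ω ∈ D <;> simp [h]
  rw [e, e]
  linarith

/-! ### Uniform integrability of the squares -/

theorem measurableSet_exists_lt_abs_sub (m : ℕ) (u : ℕ → TimeInt T) :
    MeasurableSet {ω : PathSpace T | ∃ j < m, 1 < |coord (u (j + 1)) ω - coord (u j) ω|} := by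
  have hmc : ∀ t : TimeInt T, Measurable (coord t) := fun t => (continuous_coord t).measurable
  have : {ω : PathSpace T | ∃ j < m, 1 < |coord (u (j + 1)) ω - coord (u j) ω|} =
      ⋃ j, ⋃ (_ : j < m), {ω | 1 < |coord (u (j + 1)) ω - coord (u j) ω|} := by
    ext; simp
  rw [this]
  exact MeasurableSet.iUnion fun j => MeasurableSet.iUnion fun _ =>
    measurableSet_lt measurable_const ((hmc _).sub (hmc _)).norm

/-- Comparison along a subdivision: outside the event that some increment exceeds `1`, a path with
`|B t| ≥ 2 N + 2` first reaches level `N` at a time of the subdivision where `|B| ≤ N + 1`, and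
has then at least half of `|B t|` still to run. -/
theorem setIntegral_coord_sq_le_of_subdivision (hP : IsMartingaleMeasure P) (hμ : BracketLE μ P)
    {N : ℝ} (hN : 0 < N) {m : ℕ} {u : ℕ → TimeInt T} (hu : Monotone u) (hu0 : u 0 = ⊥) :
    ∫ ω in {ω | 2 * N + 2 ≤ |coord (u m) ω|}, coord (u m) ω ^ 2 ∂(P : Measure (PathSpace T)) ≤
      ∫ ω in {ω | ∃ j < m, 1 < |coord (u (j + 1)) ω - coord (u j) ω|},
        coord (u m) ω ^ 2 ∂(P : Measure (PathSpace T)) +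
      4 * (distFun μ (u m) - distFun μ ⊥) ^ 2 / N ^ 2 := by
  set c := distFun μ (u m) - distFun μ ⊥ with hc
  have hmc : ∀ t : TimeInt T, Measurable (coord t) := fun t => (continuous_coord t).measurable
  have hma : ∀ {i j}, j ≤ i → Measurable[canonicalFiltration T (u i)] (coord (u j)) :=
    fun {i j} hij => ((hP.1 (u j)).mono ((canonicalFiltration T).mono (hu hij))).measurable
  set E := {ω : PathSpace T | 2 * N + 2 ≤ |coord (u m) ω|}
  set O := {ω : PathSpace T | ∃ j < m, 1 < |coord (u (j + 1)) ω - coord (u j) ω|}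
  -- first passage over level `N` at time `u i`, without overshooting `N + 1`
  set D : ℕ → Set (PathSpace T) := fun i =>
    {ω | N ≤ |coord (u i) ω| ∧ |coord (u i) ω| ≤ N + 1 ∧ ∀ j < i, |coord (u j) ω| < N} with hDdef
  have hDm : ∀ i, MeasurableSet[canonicalFiltration T (u i)] (D i) := by
    intro i
    have h1 : MeasurableSet {x : ℝ | N ≤ |x|} := measurableSet_le measurable_const measurable_norm
    have h2 : MeasurableSet {x : ℝ | |x| ≤ N + 1} :=
      measurableSet_le measurable_norm measurable_const
    have h3 : MeasurableSet {x : ℝ | |x| < N} := measurableSet_lt measurable_norm measurable_const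
    have e : D i = coord (u i) ⁻¹' {x : ℝ | N ≤ |x|} ∩ (coord (u i) ⁻¹' {x : ℝ | |x| ≤ N + 1} ∩
        ⋂ j, ⋂ (_ : j < i), coord (u j) ⁻¹' {x : ℝ | |x| < N}) := by
      ext; simp [hDdef]
    rw [e]
    exact (hma le_rfl h1).inter ((hma le_rfl h2).inter (MeasurableSet.iInter fun j =>
      MeasurableSet.iInter fun hj => hma hj.le h3))
  have hDm' : ∀ i, MeasurableSet (D i) := fun i => (canonicalFiltration T).le _ _ (hDm i)
  have hdisj : Pairwise (Function.onFun Disjoint D) := by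
    have : ∀ i j, i < j → Disjoint (D i) (D j) := fun i j hij =>
      Set.disjoint_left.2 fun ω hi hj => absurd hi.1 (not_le.2 (hj.2.2 i hij))
    intro i j hij
    rcases lt_or_gt_of_ne hij with h | h
    · exact this i j h
    · exact (this j i h).symm
  have hEm : MeasurableSet E := measurableSet_le measurable_const (hmc _).norm
  have hOm : MeasurableSet O := measurableSet_exists_lt_abs_sub m u
  have hsub : E ⊆ O ∪ ⋃ i ∈ Finset.range (m + 1), (E ∩ D i) := by
    intro ω hω
    by_cases hωO : ω ∈ O
    · exact Or.inl hωO
    right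
    classical
    have hex : ∃ i, N ≤ |coord (u i) ω| := ⟨m, by
      have : 2 * N + 2 ≤ |coord (u m) ω| := hω
      linarith⟩
    have hfm : Nat.find hex ≤ m := Nat.find_min' hex (by
      have : 2 * N + 2 ≤ |coord (u m) ω| := hω
      linarith)
    have hlt : ∀ j < Nat.find hex, |coord (u j) ω| < N := fun j hj => not_le.1 (Nat.find_min hex hj)
    simp only [Set.mem_iUnion, Finset.mem_range]
    refine ⟨Nat.find hex, by omega, hω, Nat.find_spec hex, ?_, hlt⟩
    rcases hk : Nat.find hex with _ | k
    · simp only [hu0, coord_bot, abs_zero]; linarith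
    · have h1 := hlt k (by omega)
      have h2 : |coord (u (k + 1)) ω - coord (u k) ω| ≤ 1 := by
        by_contra hne
        exact hωO ⟨k, by omega, not_le.1 hne⟩
      have := abs_sub_abs_le_abs_sub (coord (u (k + 1)) ω) (coord (u k) ω)
      linarith
  have hint : ∀ t, Integrable (fun ω => coord t ω ^ 2) (P : Measure (PathSpace T)) :=
    fun t => (hμ.memLp_coord t).integrable_sq
  have hint' : ∀ s t, Integrable (fun ω => (coord t ω - coord s ω) ^ 2)
      (P : Measure (PathSpace T)) := fun s t =>
    ((hμ.memLp_coord t).sub (hμ.memLp_coord s)).integrable_sq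
  have hcle : ∀ i, distFun μ (u m) - distFun μ (u i) ≤ c := fun i => by
    have := hμ.distFun_mono (bot_le : ⊥ ≤ u i)
    simp only [hc]; linarith
  have hc0 : 0 ≤ c := sub_nonneg.2 (hμ.distFun_mono bot_le)
  -- after the first passage at time `u i`
  have hstep : ∀ i ∈ Finset.range (m + 1),
      ∫ ω in E ∩ D i, coord (u m) ω ^ 2 ∂(P : Measure (PathSpace T)) ≤
      4 * c / N ^ 2 * ∫ ω in D i, coord (u m) ω ^ 2 ∂(P : Measure (PathSpace T)) := by
    intro i hi
    have him : u i ≤ u m := hu (by simpa [Nat.lt_succ_iff] using hi)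
    have h1 : ∫ ω in E ∩ D i, coord (u m) ω ^ 2 ∂(P : Measure (PathSpace T)) ≤
        ∫ ω in E ∩ D i, 4 * (coord (u m) ω - coord (u i) ω) ^ 2 ∂(P : Measure (PathSpace T)) := by
      refine setIntegral_mono_on (hint _).integrableOn ((hint' _ _).const_mul 4).integrableOn
        (hEm.inter (hDm' i)) fun ω hω => ?_
      have h2 : 2 * N + 2 ≤ |coord (u m) ω| := hω.1
      have h3 := hω.2.2.1
      have h4 := abs_sub_abs_le_abs_sub (coord (u m) ω) (coord (u i) ω)
      rw [← sq_abs (coord (u m) ω), ← sq_abs (coord (u m) ω - coord (u i) ω)]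
      have h5 : |coord (u m) ω| ≤ 2 * |coord (u m) ω - coord (u i) ω| := by linarith
      calc |coord (u m) ω| ^ 2 ≤ (2 * |coord (u m) ω - coord (u i) ω|) ^ 2 :=
            pow_le_pow_left₀ (abs_nonneg _) h5 2
        _ = _ := by ring
    have h2 : ∫ ω in E ∩ D i, (coord (u m) ω - coord (u i) ω) ^ 2 ∂(P : Measure (PathSpace T)) ≤
        ∫ ω in D i, (coord (u m) ω - coord (u i) ω) ^ 2 ∂(P : Measure (PathSpace T)) :=
      setIntegral_mono_set (hint' _ _).integrableOn (Eventually.of_forall fun _ => sq_nonneg _)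
        Set.inter_subset_right.eventuallyLE
    have h3 := setIntegral_coord_sub_sq_le hP hμ him (hDm i)
    -- Chebyshev's inequality on the first passage event
    have h4 : N ^ 2 * (P : Measure (PathSpace T)).real (D i) ≤
        ∫ ω in D i, coord (u m) ω ^ 2 ∂(P : Measure (PathSpace T)) := by
      refine le_trans ?_ (setIntegral_coord_sq_mono hP hμ him (hDm i))
      rw [mul_comm, ← smul_eq_mul, ← setIntegral_const]
      refine setIntegral_mono_on (integrable_const _).integrableOn (hint _).integrableOn
        (hDm' i) fun ω hω => ?_
      rw [← sq_abs (coord (u i) ω)]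
      exact pow_le_pow_left₀ hN.le hω.1 2
    have h5 : (P : Measure (PathSpace T)).real (D i) ≤
        (∫ ω in D i, coord (u m) ω ^ 2 ∂(P : Measure (PathSpace T))) / N ^ 2 := by
      rw [le_div_iff₀ (by positivity)]; linarith
    rw [integral_const_mul] at h1
    have h6 : (distFun μ (u m) - distFun μ (u i)) * (P : Measure (PathSpace T)).real (D i) ≤
        c * ((∫ ω in D i, coord (u m) ω ^ 2 ∂(P : Measure (PathSpace T))) / N ^ 2) :=
      mul_le_mul (hcle i) h5 measureReal_nonneg hc0
    calc _ ≤ _ := h1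
      _ ≤ 4 * (c * ((∫ ω in D i, coord (u m) ω ^ 2 ∂(P : Measure (PathSpace T))) / N ^ 2)) := by
        linarith
      _ = _ := by ring
  have hvar : ∫ ω, coord (u m) ω ^ 2 ∂(P : Measure (PathSpace T)) ≤ c := by
    have := setIntegral_coord_sub_sq_le hP hμ (bot_le : ⊥ ≤ u m) (D := Set.univ) MeasurableSet.univ
    simpa [coord_bot] using this
  have hunion : ∀ F : ℕ → Set (PathSpace T), (∀ i, MeasurableSet (F i)) → (∀ i, F i ⊆ D i) →
      ∫ ω in ⋃ i ∈ Finset.range (m + 1), F i, coord (u m) ω ^ 2 ∂(P : Measure (PathSpace T)) =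
      ∑ i ∈ Finset.range (m + 1), ∫ ω in F i, coord (u m) ω ^ 2 ∂(P : Measure (PathSpace T)) :=
    fun F hF hFD => integral_biUnion_finset _ (fun i _ => hF i)
      (fun i _ j _ hij => (hdisj hij).mono (hFD i) (hFD j)) fun i _ => (hint _).integrableOn
  calc ∫ ω in E, coord (u m) ω ^ 2 ∂(P : Measure (PathSpace T))
      ≤ ∫ ω in O ∪ ⋃ i ∈ Finset.range (m + 1), (E ∩ D i), coord (u m) ω ^ 2
          ∂(P : Measure (PathSpace T)) :=
        setIntegral_mono_set (hint _).integrableOn (Eventually.of_forall fun _ => sq_nonneg _)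
          hsub.eventuallyLE
    _ ≤ ∫ ω in O, coord (u m) ω ^ 2 ∂(P : Measure (PathSpace T)) +
        ∫ ω in ⋃ i ∈ Finset.range (m + 1), (E ∩ D i), coord (u m) ω ^ 2
          ∂(P : Measure (PathSpace T)) := by
        rw [← Set.union_sdiff_self, setIntegral_union Set.disjoint_sdiff_right
          ((Finset.measurableSet_biUnion _ fun i _ => hEm.inter (hDm' i)).diff hOm)
          (hint _).integrableOn (hint _).integrableOn]
        refine add_le_add le_rfl ?_
        exact setIntegral_mono_set (hint _).integrableOn (Eventually.of_forall fun _ => sq_nonneg _)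
          Set.sdiff_subset.eventuallyLE
    _ ≤ _ := by
        gcongr
        rw [hunion _ (fun i => hEm.inter (hDm' i)) fun i => Set.inter_subset_right]
        refine (Finset.sum_le_sum hstep).trans ?_
        rw [← Finset.mul_sum, ← hunion D hDm' fun i => le_rfl]
        have h1 : ∫ ω in ⋃ i ∈ Finset.range (m + 1), D i, coord (u m) ω ^ 2
            ∂(P : Measure (PathSpace T)) ≤ c :=
          (setIntegral_le_integral (hint _) (Eventually.of_forall fun _ => sq_nonneg _)).trans hvar
        calc _ ≤ 4 * c / N ^ 2 * c := mul_le_mul_of_nonneg_left h1 (by positivity)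
          _ = _ := by ring

end

/-! ### Refining subdivisions, and approximation by truncation -/

section

/-- The `j`-th point of the subdivision of `[0, t]` into `m + 1` equal parts, and `t` itself when
`j > m`. -/
noncomputable def uniformGrid {T : ℝ} (t : TimeInt T) (m j : ℕ) : TimeInt T :=
  ⟨min 1 ((j : ℝ) / (m + 1)) * t.1, mul_nonneg (by positivity) t.2.1,
    (mul_le_of_le_one_left t.2.1 (min_le_left _ _)).trans t.2.2⟩

theorem uniformGrid_zero {T : ℝ} [Fact (0 ≤ T)] (t : TimeInt T) (m : ℕ) : uniformGrid t m 0 = ⊥ :=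
  Subtype.ext (by simp [uniformGrid])

theorem uniformGrid_last {T : ℝ} (t : TimeInt T) (m : ℕ) : uniformGrid t m (m + 1) = t := by
  refine Subtype.ext ?_
  have h : (m : ℝ) + 1 ≠ 0 := by positivity
  simp [uniformGrid, div_self h]

theorem monotone_uniformGrid {T : ℝ} (t : TimeInt T) (m : ℕ) : Monotone (uniformGrid t m) := by
  intro i j hij
  refine Subtype.mk_le_mk.2 (mul_le_mul_of_nonneg_right (min_le_min le_rfl ?_) t.2.1)
  gcongr

theorem dist_uniformGrid_le {T : ℝ} (t : TimeInt T) (m j : ℕ) :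
    dist (uniformGrid t m (j + 1)) (uniformGrid t m j) ≤ t.1 / (m + 1) := by
  have h := monotone_uniformGrid t m j.le_succ
  have h' : (uniformGrid t m j).1 ≤ (uniformGrid t m (j + 1)).1 := h
  rw [Subtype.dist_eq, Real.dist_eq, abs_of_nonneg (sub_nonneg.2 h')]
  have h1 : min 1 (((j + 1 : ℕ) : ℝ) / (m + 1)) ≤ min 1 ((j : ℝ) / (m + 1)) + 1 / (m + 1) := by
    have h2 : (0 : ℝ) ≤ 1 / (m + 1) := by positivity
    rw [min_add, ← add_div, Nat.cast_add_one]
    exact min_le_min (by linarith) le_rfl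
  have h3 := mul_le_mul_of_nonneg_right h1 t.2.1
  have h4 : (1 : ℝ) / (m + 1) * t.1 = t.1 / (m + 1) := by ring
  simp only [uniformGrid]
  linarith [h3, h4, add_mul (min 1 ((j : ℝ) / (m + 1))) (1 / (m + 1)) t.1]

variable {T : ℝ} [Fact (0 ≤ T)] {μ : Measure (TimeInt T)} {P : ProbabilityMeasure (PathSpace T)}

/-- The squares `(B t)²` are uniformly integrable over all martingale measures with `d⟨B⟩ ≤ dμ`. -/
theorem setIntegral_coord_sq_le (hP : IsMartingaleMeasure P) (hμ : BracketLE μ P)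
    {N : ℝ} (hN : 0 < N) (t : TimeInt T) :
    ∫ ω in {ω | 2 * N + 2 ≤ |coord t ω|}, coord t ω ^ 2 ∂(P : Measure (PathSpace T)) ≤
      4 * (distFun μ t - distFun μ ⊥) ^ 2 / N ^ 2 := by
  set O : ℕ → Set (PathSpace T) := fun m => {ω | ∃ j < m + 1,
    1 < |coord (uniformGrid t m (j + 1)) ω - coord (uniformGrid t m j) ω|}
  have hO : ∀ m, MeasurableSet (O m) := fun m => measurableSet_exists_lt_abs_sub _ _
  have hle : ∀ m, ∫ ω in {ω | 2 * N + 2 ≤ |coord t ω|}, coord t ω ^ 2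
      ∂(P : Measure (PathSpace T)) ≤ ∫ ω, (O m).indicator (fun ω => coord t ω ^ 2) ω
        ∂(P : Measure (PathSpace T)) + 4 * (distFun μ t - distFun μ ⊥) ^ 2 / N ^ 2 := fun m => by
    have := setIntegral_coord_sq_le_of_subdivision hP hμ hN (m := m + 1)
      (monotone_uniformGrid t m) (uniformGrid_zero t m)
    rw [integral_indicator (hO m)]
    simpa only [uniformGrid_last] using this
  have hint : Integrable (fun ω => coord t ω ^ 2) (P : Measure (PathSpace T)) :=
    (hμ.memLp_coord t).integrable_sq
  -- every path is uniformly continuous, hence leaves `O m` for large `m`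
  have hev : ∀ ω, ∀ᶠ m in atTop, ω ∉ O m := by
    intro ω
    have huc : UniformContinuous ω.1 :=
      CompactSpace.uniformContinuous_of_continuous ω.1.continuous
    obtain ⟨δ, hδ, h⟩ := Metric.uniformContinuous_iff.1 huc 1 one_pos
    have hlim : Tendsto (fun m : ℕ => t.1 / ((m : ℝ) + 1)) atTop (𝓝 0) := by
      simpa [div_eq_mul_inv] using
        (tendsto_one_div_add_atTop_nhds_zero_nat (𝕜 := ℝ)).const_mul t.1
    filter_upwards [hlim.eventually_lt_const hδ] with m hm
    rintro ⟨j, -, hj⟩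
    have := h ((dist_uniformGrid_le t m j).trans_lt hm)
    rw [Real.dist_eq] at this
    exact lt_asymm hj this
  have hlim : Tendsto (fun m => ∫ ω, (O m).indicator (fun ω => coord t ω ^ 2) ω
      ∂(P : Measure (PathSpace T))) atTop (𝓝 0) := by
    have := tendsto_integral_of_dominated_convergence (μ := (P : Measure (PathSpace T)))
      (F := fun m => (O m).indicator fun ω => coord t ω ^ 2) (f := fun _ => 0)
      (fun ω => coord t ω ^ 2) (fun m => (hint.indicator (hO m)).1) hint
      (fun m => Eventually.of_forall fun ω => (norm_indicator_le_norm_self _ _).trans_eq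
        (Real.norm_of_nonneg (sq_nonneg _)))
      (Eventually.of_forall fun ω => tendsto_const_nhds.congr' (by
        filter_upwards [hev ω] with m hm
        rw [Set.indicator_of_notMem hm]))
    simpa using this
  simpa using ge_of_tendsto' (hlim.add_const _) hle

theorem eLpNorm_two_eq_ofReal_sqrt {Ω : Type*} {m : MeasurableSpace Ω} {ν : Measure Ω} {f : Ω → ℝ}
    (hf : MemLp f 2 ν) : eLpNorm f 2 ν = ENNReal.ofReal √(∫ ω, f ω ^ 2 ∂ν) := by
  rw [hf.eLpNorm_eq_integral_rpow_norm (by norm_num) (by norm_num), Real.sqrt_eq_rpow]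
  simp

variable {𝔓 : Set (ProbabilityMeasure (PathSpace T))}

theorem capFun_of_continuous {f : PathSpace T → ℝ} (hf : Continuous f) :
    capFun 𝔓 f = ⨆ P : 𝔓, eLpNorm f 2 (P.1 : Measure (PathSpace T)) := by
  have : LowerSemicontinuous fun ω => ‖f ω‖ₑ := (continuous_enorm.comp hf).lowerSemicontinuous
  rw [capFun, cap_of_lsc 𝔓 this]
  exact iSup_congr fun P => eLpNorm_enorm _

/-- The truncation `k max(-|K|, min(|K|, B t))` of `k B t`. -/
noncomputable def truncCoord (k : PathSpace T →ᵇ ℝ) (t : TimeInt T) (K : ℝ) : PathSpace T →ᵇ ℝ :=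
  k * BoundedContinuousFunction.ofNormedAddCommGroup
    (fun ω => max (-|K|) (min |K| (coord t ω)))
    (continuous_const.max (continuous_const.min (continuous_coord t))) |K| fun _ =>
      abs_le.2 ⟨le_max_left _ _, max_le (neg_le_self (abs_nonneg K)) (min_le_left _ _)⟩

theorem mul_coord_mem_quasiSubmodule (h𝔓_mart : ∀ P ∈ 𝔓, IsMartingaleMeasure P)
    (h𝔓_bracket : ∀ P ∈ 𝔓, BracketLE μ P) (k : PathSpace T →ᵇ ℝ) (t : TimeInt T) :
    (fun ω => k ω * coord t ω) ∈ quasiSubmodule 𝔓 := by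
  intro ε hε
  set c := distFun μ t - distFun μ ⊥
  have hlim : Tendsto (fun N : ℝ => ENNReal.ofReal ‖k‖ * ENNReal.ofReal √(4 * c ^ 2 / N ^ 2)) atTop
      (𝓝 0) := by
    have h1 : Tendsto (fun N : ℝ => 4 * c ^ 2 / N ^ 2) atTop (𝓝 0) :=
      tendsto_const_nhds.div_atTop (tendsto_pow_atTop (by norm_num))
    have h2 := ENNReal.tendsto_ofReal ((Real.continuous_sqrt.tendsto 0).comp h1)
    have h3 := ENNReal.Tendsto.const_mul (a := ENNReal.ofReal ‖k‖) h2 (Or.inr ENNReal.ofReal_ne_top)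
    simpa using h3
  obtain ⟨N, hNε, hN⟩ := ((hlim.eventually_lt_const hε).and (eventually_gt_atTop 0)).exists
  refine ⟨truncCoord k t (2 * N + 2), lt_of_le_of_lt ?_ hNε⟩
  have hcont : Continuous
      ((fun ω => k ω * coord t ω) - (truncCoord k t (2 * N + 2) : PathSpace T → ℝ)) :=
    (k.continuous.mul (continuous_coord t)).sub (truncCoord k t (2 * N + 2)).continuous
  rw [capFun_of_continuous hcont]
  refine iSup_le fun P => ?_
  have hP := h𝔓_mart P.1 P.2
  have hμ := h𝔓_bracket P.1 P.2
  set E := {ω : PathSpace T | 2 * N + 2 ≤ |coord t ω|}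
  have hE : MeasurableSet E :=
    measurableSet_le measurable_const (continuous_coord t).measurable.norm
  have hmem : MemLp (E.indicator (coord t)) 2 (P.1 : Measure (PathSpace T)) :=
    (hμ.memLp_coord t).indicator hE
  have hnorm : eLpNorm (E.indicator (coord t)) 2 (P.1 : Measure (PathSpace T)) ≤
      ENNReal.ofReal √(4 * c ^ 2 / N ^ 2) := by
    rw [eLpNorm_two_eq_ofReal_sqrt hmem]
    refine ENNReal.ofReal_le_ofReal (Real.sqrt_le_sqrt (le_trans (le_of_eq ?_)
      (setIntegral_coord_sq_le hP hμ hN t)))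
    rw [← integral_indicator hE]
    refine integral_congr_ae (Eventually.of_forall fun ω => ?_)
    by_cases h : ω ∈ E <;> simp [E, h]
  refine le_trans ?_ (mul_le_mul_right hnorm _)
  refine eLpNorm_le_mul_eLpNorm_of_ae_le_mul (Eventually.of_forall fun ω => ?_) 2
  have hK : |2 * N + 2| = 2 * N + 2 := abs_of_pos (by linarith)
  have e : ((fun ω => k ω * coord t ω) - (truncCoord k t (2 * N + 2) : PathSpace T → ℝ)) ω =
      k ω * (coord t ω - max (-(2 * N + 2)) (min (2 * N + 2) (coord t ω))) := by
    simp only [truncCoord, Pi.sub_apply, BoundedContinuousFunction.coe_mul, Pi.mul_apply,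
      BoundedContinuousFunction.coe_ofNormedAddCommGroup, hK]
    ring
  rw [e, norm_mul]
  refine mul_le_mul (k.norm_coe_le_norm ω) ?_ (norm_nonneg _) (norm_nonneg _)
  by_cases h : ω ∈ E
  · rw [Set.indicator_of_mem h, Real.norm_eq_abs, Real.norm_eq_abs]
    rcases le_total 0 (coord t ω) with h0 | h0
    · rw [max_eq_right (le_trans (by linarith) (le_min (by linarith : 0 ≤ 2 * N + 2) h0)),
        abs_of_nonneg (sub_nonneg.2 (min_le_right _ _)), abs_of_nonneg h0]
      linarith [le_min (by linarith : 0 ≤ 2 * N + 2) h0]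
    · have h1 : max (-(2 * N + 2)) (min (2 * N + 2) (coord t ω)) ≤ 0 :=
        max_le (by linarith) ((min_le_right _ _).trans h0)
      rw [min_eq_right (by linarith)] at h1 ⊢
      rw [abs_of_nonpos (sub_nonpos.2 (le_max_right _ _)), abs_of_nonpos h0]
      linarith
  · have h1 : |coord t ω| < 2 * N + 2 := not_le.1 h
    rw [abs_lt] at h1
    rw [Set.indicator_of_notMem h, min_eq_right h1.2.le, max_eq_right h1.1.le]
    simp

end

/-! ### The energy inequality -/

section

theorem measureReal_Ioc_eq_sub {T : ℝ} {μ : Measure (TimeInt T)} [IsFiniteMeasure μ]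
    {s t : TimeInt T} (hst : s ≤ t) : μ.real (Set.Ioc s t) = distFun μ t - distFun μ s := by
  rw [← Set.Iic_sdiff_Iic, measureReal_sdiff (Set.Iic_subset_Iic.2 hst) measurableSet_Iic]
  rfl

variable {T : ℝ} [Fact (0 ≤ T)] {μ : Measure (TimeInt T)} {P : ProbabilityMeasure (PathSpace T)}
  {𝔓 : Set (ProbabilityMeasure (PathSpace T))}

theorem ElemData.process_sq (d : ElemData T) (s : TimeInt T) (ω : PathSpace T) :
    d.process s ω ^ 2 = ∑ i ∈ Finset.range d.n,
      d.k i ω ^ 2 * (Set.Ioc (d.t i) (d.t (i + 1))).indicator 1 s := by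
  have hz : ∀ i j, i ≠ j → (Set.Ioc (d.t i) (d.t (i + 1))).indicator (1 : TimeInt T → ℝ) s *
      (Set.Ioc (d.t j) (d.t (j + 1))).indicator 1 s = 0 := by
    intro i j hij
    by_cases h : s ∈ Set.Ioc (d.t i) (d.t (i + 1))
    · have : s ∉ Set.Ioc (d.t j) (d.t (j + 1)) :=
        Set.disjoint_left.1 (d.monotone.pairwise_disjoint_on_Ioc_succ hij) h
      rw [Set.indicator_of_notMem this, mul_zero]
    · rw [Set.indicator_of_notMem h, zero_mul]
  rw [pow_two, ElemData.process, Finset.sum_mul_sum]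
  refine Finset.sum_congr rfl fun i hi => ?_
  rw [Finset.sum_eq_single_of_mem i hi fun j _ hj => ?_]
  · by_cases h : s ∈ Set.Ioc (d.t i) (d.t (i + 1)) <;> simp [h, pow_two]
  · rw [mul_mul_mul_comm, hz i j hj.symm, mul_zero]

theorem ElemData.energy_process [IsFiniteMeasure μ] (d : ElemData T) :
    energy μ P d.process = √(∑ i ∈ Finset.range d.n, (distFun μ (d.t (i + 1)) - distFun μ (d.t i)) *
      ∫ ω, d.k i ω ^ 2 ∂(P : Measure (PathSpace T))) := by
  rw [energy]
  congr 1
  have h1 : ∀ ω, ∫ s, d.process s ω ^ 2 ∂μ = ∑ i ∈ Finset.range d.n,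
      (distFun μ (d.t (i + 1)) - distFun μ (d.t i)) * d.k i ω ^ 2 := by
    intro ω
    simp_rw [d.process_sq]
    have hi : ∀ i, Integrable (fun s => d.k i ω ^ 2 *
        (Set.Ioc (d.t i) (d.t (i + 1))).indicator (1 : TimeInt T → ℝ) s) μ := fun i =>
      ((integrable_const (1 : ℝ)).indicator measurableSet_Ioc).const_mul _
    rw [integral_finsetSum _ fun i _ => hi i]
    refine Finset.sum_congr rfl fun i _ => ?_
    rw [integral_const_mul, integral_indicator_one measurableSet_Ioc,
      measureReal_Ioc_eq_sub (d.monotone i.le_succ), mul_comm]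
  simp_rw [h1]
  have hk : ∀ i, Integrable (fun ω => d.k i ω ^ 2) (P : Measure (PathSpace T)) := fun i =>
    ((d.k i) ^ 2).integrable _
  rw [integral_finsetSum _ fun i _ => (hk i).const_mul _]
  exact Finset.sum_congr rfl fun i _ => integral_const_mul _ _

/-- The increments `k i (B (t (i + 1)) - B (t i))` are orthogonal in `L²(P)`, and the conditional
variance bound controls each of them. -/
theorem ElemData.integral_sum_sq_le (d : ElemData T) (hP : IsMartingaleMeasure P)
    (hμ : BracketLE μ P) (n : ℕ) :
    MemLp (fun ω => ∑ i ∈ Finset.range n, d.k i ω * (coord (d.t (i + 1)) ω - coord (d.t i) ω)) 2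
      (P : Measure (PathSpace T)) ∧
    ∫ ω, (∑ i ∈ Finset.range n, d.k i ω * (coord (d.t (i + 1)) ω - coord (d.t i) ω)) ^ 2
        ∂(P : Measure (PathSpace T)) ≤
      ∑ i ∈ Finset.range n, (distFun μ (d.t (i + 1)) - distFun μ (d.t i)) *
        ∫ ω, d.k i ω ^ 2 ∂(P : Measure (PathSpace T)) := by
  have hΔ : ∀ s t, MemLp (fun ω => coord t ω - coord s ω) 2 (P : Measure (PathSpace T)) :=
    fun s t => (hμ.memLp_coord t).sub (hμ.memLp_coord s)
  have hkm : ∀ i, AEStronglyMeasurable (d.k i) (P : Measure (PathSpace T)) := fun i =>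
    (d.k i).continuous.aestronglyMeasurable
  have hkΔ : ∀ i, MemLp (fun ω => d.k i ω * (coord (d.t (i + 1)) ω - coord (d.t i) ω)) 2
      (P : Measure (PathSpace T)) := fun i =>
    (hΔ _ _).of_le_mul (c := ‖d.k i‖) ((hkm i).mul (hΔ _ _).1) (Eventually.of_forall fun ω => by
      rw [norm_mul]
      exact mul_le_mul_of_nonneg_right ((d.k i).norm_coe_le_norm ω) (norm_nonneg _))
  induction n with
  | zero => simp
  | succ n ih =>
    obtain ⟨hX, hle⟩ := ih
    set X : PathSpace T → ℝ := fun ω =>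
      ∑ i ∈ Finset.range n, d.k i ω * (coord (d.t (i + 1)) ω - coord (d.t i) ω)
    set c := distFun μ (d.t (n + 1)) - distFun μ (d.t n)
    have hst : d.t n ≤ d.t (n + 1) := d.monotone n.le_succ
    simp_rw [Finset.sum_range_succ]
    refine ⟨hX.add (hkΔ n), ?_⟩
    have hXm : StronglyMeasurable[canonicalFiltration T (d.t n)] X := by
      refine Finset.stronglyMeasurable_fun_sum _ fun i hi => ?_
      have hi' := Finset.mem_range.1 hi
      exact ((d.measurable i).stronglyMeasurable.mono
        ((canonicalFiltration T).mono (d.monotone hi'.le))).mul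
        (((hP.1 _).mono ((canonicalFiltration T).mono (d.monotone hi'))).sub
          ((hP.1 _).mono ((canonicalFiltration T).mono (d.monotone hi'.le))))
    have hi : ∀ t, Integrable (fun ω => d.k n ω * (X ω * coord t ω))
        (P : Measure (PathSpace T)) := fun t =>
      integrable_mul_mul_of_bound (hkm n) (fun ω => (d.k n).norm_coe_le_norm ω) hX
        (hμ.memLp_coord t)
    have hcross : ∫ ω, d.k n ω * (X ω * coord (d.t (n + 1)) ω) ∂(P : Measure (PathSpace T)) =
        ∫ ω, d.k n ω * (X ω * coord (d.t n) ω) ∂(P : Measure (PathSpace T)) := by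
      simp_rw [← mul_assoc]
      exact integral_mul_eq_of_martingale hP hst (G := fun ω => d.k n ω * X ω)
        ((d.measurable n).stronglyMeasurable.mul hXm)
        (by simpa only [← mul_assoc] using hi (d.t (n + 1)))
    have hvar : ∫ ω, d.k n ω ^ 2 * (coord (d.t (n + 1)) ω - coord (d.t n) ω) ^ 2
        ∂(P : Measure (PathSpace T)) ≤ c * ∫ ω, d.k n ω ^ 2 ∂(P : Measure (PathSpace T)) :=
      integral_mul_coord_sub_sq_le hP hμ hst (G := fun ω => d.k n ω ^ 2)
        ((d.measurable n).pow_const 2).stronglyMeasurable (fun ω => sq_nonneg _) (C := ‖d.k n‖ ^ 2)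
        fun ω => by
          rw [← sq_abs]
          exact pow_le_pow_left₀ (abs_nonneg _) ((d.k n).norm_coe_le_norm ω) 2
    have e : ∀ ω, (X ω + d.k n ω * (coord (d.t (n + 1)) ω - coord (d.t n) ω)) ^ 2 =
        X ω ^ 2 + (2 * (d.k n ω * (X ω * coord (d.t (n + 1)) ω) -
          d.k n ω * (X ω * coord (d.t n) ω)) +
        (d.k n ω * (coord (d.t (n + 1)) ω - coord (d.t n) ω)) ^ 2) := fun ω => by ring
    have hi2 : Integrable (fun ω => 2 * (d.k n ω * (X ω * coord (d.t (n + 1)) ω) -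
        d.k n ω * (X ω * coord (d.t n) ω))) (P : Measure (PathSpace T)) :=
      ((hi (d.t (n + 1))).sub (hi (d.t n))).const_mul 2
    have hi3 : Integrable (fun ω => 2 * (d.k n ω * (X ω * coord (d.t (n + 1)) ω) -
        d.k n ω * (X ω * coord (d.t n) ω)) +
        (d.k n ω * (coord (d.t (n + 1)) ω - coord (d.t n) ω)) ^ 2) (P : Measure (PathSpace T)) :=
      hi2.add (hkΔ n).integrable_sq
    change ∫ ω, (X ω + d.k n ω * (coord (d.t (n + 1)) ω - coord (d.t n) ω)) ^ 2
      ∂(P : Measure (PathSpace T)) ≤ _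
    simp_rw [e]
    rw [integral_add hX.integrable_sq hi3,
      integral_add hi2 (hkΔ n).integrable_sq, integral_const_mul, integral_sub (hi _) (hi _),
      hcross, sub_self, mul_zero, zero_add]
    simp_rw [mul_pow]
    exact add_le_add hle hvar

theorem ElemData.continuous_integral (d : ElemData T) : Continuous d.integral :=
  continuous_finsetSum _ fun i _ =>
    (d.k i).continuous.mul ((continuous_coord _).sub (continuous_coord _))

theorem ElemData.capFun_integral_le [IsFiniteMeasure μ] (d : ElemData T)
    (h𝔓_mart : ∀ P ∈ 𝔓, IsMartingaleMeasure P) (h𝔓_bracket : ∀ P ∈ 𝔓, BracketLE μ P) :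
    capFun 𝔓 d.integral ≤ ENNReal.ofReal ‖d.toElem 𝔓 μ‖ := by
  rw [capFun_of_continuous d.continuous_integral]
  refine iSup_le fun P => ?_
  obtain ⟨hm, hle⟩ := d.integral_sum_sq_le (h𝔓_mart P.1 P.2) (h𝔓_bracket P.1 P.2) d.n
  have h1 := eLpNorm_two_eq_ofReal_sqrt hm
  refine h1.trans_le (ENNReal.ofReal_le_ofReal ((Real.sqrt_le_sqrt hle).trans ?_))
  rw [← d.energy_process, ElemProc.norm_def]
  exact le_ciSup (d.toElem 𝔓 μ).bddAbove_energy P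

theorem ElemData.integral_mem_quasiSubmodule (d : ElemData T)
    (h𝔓_mart : ∀ P ∈ 𝔓, IsMartingaleMeasure P) (h𝔓_bracket : ∀ P ∈ 𝔓, BracketLE μ P) :
    d.integral ∈ quasiSubmodule 𝔓 := by
  have e : d.integral = ∑ i ∈ Finset.range d.n, ((fun ω => d.k i ω * coord (d.t (i + 1)) ω) -
      fun ω => d.k i ω * coord (d.t i) ω) := by
    ext ω
    simp [ElemData.integral, mul_sub]
  rw [e]
  exact Submodule.sum_mem _ fun i _ => Submodule.sub_mem _
    (mul_coord_mem_quasiSubmodule h𝔓_mart h𝔓_bracket _ _)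
    (mul_coord_mem_quasiSubmodule h𝔓_mart h𝔓_bracket _ _)

/-! ### The integral and its extension -/

/-- Data representing an elementary process. -/
noncomputable def ElemProc.data (h : ElemProc 𝔓 μ) : ElemData T := h.2.choose

theorem ElemProc.process_data (h : ElemProc 𝔓 μ) : h.data.process = h.toFun := h.2.choose_spec

theorem ElemProc.toElem_data (h : ElemProc 𝔓 μ) : h.data.toElem 𝔓 μ = h :=
  Subtype.ext h.process_data

/-- The elementary integral as a linear map `ℋ_e → ℒ`, defined through an arbitrary choice of data
for each process. -/
noncomputable def elemIntegral (h𝔓_mart : ∀ P ∈ 𝔓, IsMartingaleMeasure P)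
    (h𝔓_bracket : ∀ P ∈ 𝔓, BracketLE μ P) : ElemProc 𝔓 μ →ₗ[ℝ] QuasiSpace 𝔓 where
  toFun h := ⟨h.data.integral, h.data.integral_mem_quasiSubmodule h𝔓_mart h𝔓_bracket⟩
  map_add' h g := Subtype.ext <| by
    have := ElemData.integral_eq_of_process_eq 1 h.data g.data (h + g).data (by
      simp only [ElemProc.process_data, one_smul]; rfl)
    rwa [one_smul] at this
  map_smul' a h := Subtype.ext <| by
    -- `a • h = (a - 1) • h + h` puts a multiple into the form of a combination
    have := ElemData.integral_eq_of_process_eq (a - 1) h.data h.data (a • h).data (by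
      simp only [ElemProc.process_data]
      rw [sub_smul, one_smul, sub_add_cancel]; rfl)
    rwa [sub_smul, one_smul, sub_add_cancel] at this

theorem elemIntegral_toElem (h𝔓_mart : ∀ P ∈ 𝔓, IsMartingaleMeasure P)
    (h𝔓_bracket : ∀ P ∈ 𝔓, BracketLE μ P) (d : ElemData T) :
    (elemIntegral h𝔓_mart h𝔓_bracket (d.toElem 𝔓 μ)).toFun = d.integral := by
  have := ElemData.integral_eq_of_process_eq 0 d d (d.toElem 𝔓 μ).data (by
    rw [ElemProc.process_data, zero_smul, zero_add]; rfl)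
  rw [zero_smul, zero_add] at this
  exact this

theorem norm_elemIntegral_le [IsFiniteMeasure μ] (h𝔓_mart : ∀ P ∈ 𝔓, IsMartingaleMeasure P)
    (h𝔓_bracket : ∀ P ∈ 𝔓, BracketLE μ P) (h : ElemProc 𝔓 μ) :
    ‖elemIntegral h𝔓_mart h𝔓_bracket h‖ ≤ ‖h‖ := by
  have := h.data.capFun_integral_le h𝔓_mart h𝔓_bracket
  rw [h.toElem_data] at this
  rw [QuasiSpace.norm_def]
  exact ENNReal.toReal_le_of_le_ofReal (norm_nonneg _) this

/-- A contraction into a complete seminormed space extends uniquely to the completion, with values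
in the separation quotient. -/
theorem exists_unique_completion_extension {E F : Type*} [SeminormedAddCommGroup E]
    [NormedSpace ℝ E] [SeminormedAddCommGroup F] [NormedSpace ℝ F] [CompleteSpace F]
    (f : E →ₗ[ℝ] F) (hf : ∀ x, ‖f x‖ ≤ ‖x‖) :
    ∃ I : UniformSpace.Completion E →L[ℝ] SeparationQuotient F,
      (∀ x : E, I (x : UniformSpace.Completion E) = SeparationQuotient.mk (f x)) ∧
      (∀ x, ‖I x‖ ≤ ‖x‖) ∧
      ∀ J : UniformSpace.Completion E →L[ℝ] SeparationQuotient F,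
        (∀ x : E, J (x : UniformSpace.Completion E) = SeparationQuotient.mk (f x)) → J = I := by
  let g : E →L[ℝ] SeparationQuotient F :=
    (SeparationQuotient.mkCLM ℝ F).comp (f.mkContinuous 1 fun x => by simpa using hf x)
  let I := g.extend (UniformSpace.Completion.toComplL (𝕜 := ℝ) (E := E))
  have hI : ∀ x : E, I (x : UniformSpace.Completion E) = SeparationQuotient.mk (f x) := fun x =>
    ContinuousLinearMap.extend_eq g UniformSpace.Completion.denseRange_coe
      (UniformSpace.Completion.isUniformInducing_coe E) x
  refine ⟨I, hI, fun x => ?_, fun J hJ => ?_⟩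
  · induction x using UniformSpace.Completion.induction_on with
    | hp => exact isClosed_le I.continuous.norm continuous_norm
    | ih x =>
      rw [hI, UniformSpace.Completion.norm_coe, SeparationQuotient.norm_mk]
      exact hf x
  · ext x
    exact UniformSpace.Completion.ext' J.continuous I.continuous
      (fun x => (hJ x).trans (hI x).symm) x

end

end QSInt

open QSInt
/-- The quasi-sure stochastic integral. -/
theorem theorem2p8 (T : ℝ) [Fact (0 ≤ T)]
    (μ : Measure (TimeInt T)) [IsFiniteMeasure μ]
    (hμ_ne : μ ≠ 0) (hμ_cont : Continuous (distFun μ))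
    (𝔓 : Set (ProbabilityMeasure (PathSpace T)))
    (h𝔓_mart : ∀ P ∈ 𝔓, IsMartingaleMeasure P)
    (h𝔓_bracket : ∀ P ∈ 𝔓, BracketLE μ P) :
    ∃ I₀ : ElemProc 𝔓 μ →ₗ[ℝ] QuasiSpace 𝔓,
      (∀ d : ElemData T, (I₀ (d.toElem 𝔓 μ)).toFun = d.integral) ∧
      (∀ h : ElemProc 𝔓 μ, ‖I₀ h‖ ≤ ‖h‖) ∧
      ∃ I : IntegrandSpace 𝔓 μ →L[ℝ] QuasiQuotient 𝔓,
        (∀ h : ElemProc 𝔓 μ, I (h : IntegrandSpace 𝔓 μ) = SeparationQuotient.mk (I₀ h)) ∧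
        (∀ h : IntegrandSpace 𝔓 μ, ‖I h‖ ≤ ‖h‖) ∧
        ∀ J : IntegrandSpace 𝔓 μ →L[ℝ] QuasiQuotient 𝔓,
          (∀ h : ElemProc 𝔓 μ, J (h : IntegrandSpace 𝔓 μ) = SeparationQuotient.mk (I₀ h)) →
            J = I :=
  ⟨elemIntegral h𝔓_mart h𝔓_bracket, elemIntegral_toElem h𝔓_mart h𝔓_bracket,
    norm_elemIntegral_le h𝔓_mart h𝔓_bracket,
    exists_unique_completion_extension _ (norm_elemIntegral_le h𝔓_mart h𝔓_bracket)⟩
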